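/- **Theorem (Pre-clipped Muon with smooth shrinkage).** Let $m,n\ge 1$, $r=\min\{m,n\}$, $q=\max\{m,n\}$, $D=\sqrt{q/r}$. Let $f:\mathbb R^{m\times n}\to\mathbb R$ be differentiable and bounded below, and let $L>0$ be such that $$f(Y)\le f(X)+\langle\nabla f(X),Y-X\rangle+\tfrac L2\|Y-X\|_F^2\qquad\text{for all }X,Y\in\mathbb R^{m\times n}.$$ Let $X_0\in\mathbb R^{m\times n}$ be deterministic and $\Delta=f(X_0)-\inf_X f(X)$. Let $T,N\ge1$ be integers, $0\le\alpha\le1$ and $\sigma,\gamma>0$. For $0\le k<T$ let $0\le\sigma_k\le\sigma$ and $0<\gamma_k\le\gamma$ be deterministic. Let $\Xi_k^{(\ell)}$ ($0\le k<T$, $1\le\ell\le N$) be independent random $m\times n$ matrices such that, for each $k$, the matrices $\Xi_k^{(1)},\dots,\Xi_k^{(N)}$ are identically distributed and each of their entries has the law $(1-\alpha)\,\mathcal N(0,\sigma_k^2)+\alpha\,\mathrm{Cauchy}(0,\gamma_k)$. The entries of one matrix may depend on each other. For $c>0$ let $S_c(x)=xe^{-|x|/c}$, applied to matrices entry by entry.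 For a compact singular value decomposition $M=U\Sigma V^T$ (orthonormal columns in $U$ and $V$, positive singular values on the diagonal of $\Sigma$) let $\operatorname{msign}(M)=UV^T$. With $G_k=\nabla f(X_k)$ consider $$\bar G_k=\frac1N\sum_{\ell=1}^N S_c\big(G_k+\Xi_k^{(\ell)}\big),\qquad X_{k+1}=X_k-\eta\,\operatorname{msign}(\bar G_k),\qquad \eta=\sqrt{\frac{2\Delta}{LrT}},\qquad 0\le k<T.$$ Suppose that for some $B<\infty$, almost surely, $\max_{i,j}|(G_k)_{ij}|\le B$ for all $0\le k<T$, and that $$c\ge\max\left\{8\sqrt r\left[B+\sqrt{\tfrac8\pi}\,(1-\alpha)\sigma\right],\ \frac{128\,\alpha\gamma\sqrt r}{\pi}\log\left(e+\frac{128\,\alpha\sqrt r}{\pi}\right)\right\}.$$ Put $v_c=(1-\alpha)\sigma^2+\dfrac{8\alpha\gamma c}{\pi e}$ and let $\|\cdot\|_*$ be the nuclear norm. Then $\|G_k\|_*$ is integrable for $0\le k<T$, and $$\frac1T\sum_{k=0}^{T-1}\mathbb E\|G_k\|_*\le 2\sqrt{\frac{2Lr\Delta}{T}}+4Dr^{3/2}\sqrt{\frac{v_c}{N}}.$$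 Consequently, for every $\varepsilon>0$, if $T\ge 32Lr\Delta/\varepsilon^2$ and $N\ge 64D^2r^3v_c/\varepsilon^2$, then $$\frac1T\sum_{k=0}^{T-1}\mathbb E\|G_k\|_*\le\varepsilon.$$ -/

import Mathlib

open MeasureTheory ProbabilityTheory
open scoped Matrix NNReal

/-- `M = U * diag(s) * Vᵀ` is a compact singular value decomposition of the real matrix `M`: the
columns of `U` and of `V` are orthonormal and the singular values `s i` are strictly positive. -/
structure IsCompactSVD {m n ρ : ℕ} (M : Matrix (Fin m) (Fin n) ℝ)
    (U : Matrix (Fin m) (Fin ρ) ℝ) (s : Fin ρ → ℝ) (V : Matrix (Fin n) (Fin ρ) ℝ) : Prop where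
  left_orthonormal : Uᵀ * U = 1
  right_orthonormal : Vᵀ * V = 1
  pos : ∀ i, 0 < s i
  eq_mul : M = U * Matrix.diagonal s * Vᵀ

namespace IsCompactSVD

variable {m n ρ ρ' : ℕ} {M : Matrix (Fin m) (Fin n) ℝ}

theorem mul_gram_pow {U : Matrix (Fin m) (Fin ρ) ℝ} {s : Fin ρ → ℝ}
    {V : Matrix (Fin n) (Fin ρ) ℝ} (h : IsCompactSVD M U s V) (j : ℕ) :
    M * (Mᵀ * M) ^ j = U * Matrix.diagonal (fun i => s i * (s i ^ 2) ^ j) * Vᵀ := by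
  induction j with
  | zero => simpa using h.eq_mul
  | succ j ih =>
    have hT : Mᵀ = V * Matrix.diagonal s * Uᵀ := by
      rw [h.eq_mul]
      simp [Matrix.transpose_mul, Matrix.mul_assoc]
    have hG : Mᵀ * M = V * Matrix.diagonal (fun i => s i * s i) * Vᵀ := by
      calc Mᵀ * M = (V * Matrix.diagonal s * Uᵀ) * (U * Matrix.diagonal s * Vᵀ) := by
            rw [hT, ← h.eq_mul]
        _ = V * Matrix.diagonal s * (Uᵀ * U) * Matrix.diagonal s * Vᵀ := by
            simp only [Matrix.mul_assoc]
        _ = _ := by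
            rw [h.left_orthonormal, Matrix.mul_one, Matrix.mul_assoc V,
              Matrix.diagonal_mul_diagonal]
    rw [pow_succ, ← Matrix.mul_assoc, ih, hG]
    calc _ = U * Matrix.diagonal (fun i => s i * (s i ^ 2) ^ j) * (Vᵀ * V) *
          Matrix.diagonal (fun i => s i * s i) * Vᵀ := by
            simp only [Matrix.mul_assoc]
      _ = _ := by
        rw [h.right_orthonormal, Matrix.mul_one, Matrix.mul_assoc U,
          Matrix.diagonal_mul_diagonal]
        congr 3
        funext i
        ring

theorem mul_aeval_gram {U : Matrix (Fin m) (Fin ρ) ℝ} {s : Fin ρ → ℝ}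
    {V : Matrix (Fin n) (Fin ρ) ℝ} (h : IsCompactSVD M U s V) (p : Polynomial ℝ) :
    M * Polynomial.aeval (Mᵀ * M) p =
      U * Matrix.diagonal (fun i => s i * p.eval (s i ^ 2)) * Vᵀ := by
  induction p using Polynomial.induction_on' with
  | add p q hp hq =>
    rw [map_add, Matrix.mul_add, hp, hq, ← Matrix.add_mul, ← Matrix.mul_add,
      Matrix.diagonal_add]
    simp [mul_add]
  | monomial j a =>
    rw [Polynomial.aeval_monomial, ← Algebra.smul_def, Matrix.mul_smul, h.mul_gram_pow,
      ← Matrix.smul_mul, ← Matrix.mul_smul, ← Matrix.diagonal_smul]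
    congr 3
    funext i
    simp
    ring

/-- The product `U * Vᵀ` does not depend on the chosen compact singular value decomposition. -/
theorem polar_unique {U : Matrix (Fin m) (Fin ρ) ℝ} {s : Fin ρ → ℝ}
    {V : Matrix (Fin n) (Fin ρ) ℝ} {U' : Matrix (Fin m) (Fin ρ') ℝ} {s' : Fin ρ' → ℝ}
    {V' : Matrix (Fin n) (Fin ρ') ℝ} (h : IsCompactSVD M U s V)
    (h' : IsCompactSVD M U' s' V') : U * Vᵀ = U' * V'ᵀ := by
  classical
  let S : Finset ℝ := Finset.univ.image (fun i => s i ^ 2) ∪ Finset.univ.image (fun i => s' i ^ 2)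
  let p : Polynomial ℝ := Lagrange.interpolate S id (fun x => (√x)⁻¹)
  have hp : ∀ x ∈ S, p.eval x = (√x)⁻¹ := fun x hx =>
    Lagrange.eval_interpolate_at_node (v := id) _ (Function.injective_id.injOn) hx
  have e1 : (fun i => s i * p.eval (s i ^ 2)) = fun _ => 1 := by
    funext i
    rw [hp _ (by simp [S]), Real.sqrt_sq (h.pos i).le, mul_inv_cancel₀ (h.pos i).ne']
  have e2 : (fun i => s' i * p.eval (s' i ^ 2)) = fun _ => 1 := by
    funext i
    rw [hp _ (by simp [S]), Real.sqrt_sq (h'.pos i).le, mul_inv_cancel₀ (h'.pos i).ne']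
  have a := h.mul_aeval_gram p
  have b := h'.mul_aeval_gram p
  rw [e1, Matrix.diagonal_one, Matrix.mul_one] at a
  rw [e2, Matrix.diagonal_one, Matrix.mul_one] at b
  rw [← a, b]

end IsCompactSVD

theorem exists_isCompactSVD {m n : ℕ} (M : Matrix (Fin m) (Fin n) ℝ) :
    ∃ (ρ : ℕ) (U : Matrix (Fin m) (Fin ρ) ℝ) (s : Fin ρ → ℝ) (V : Matrix (Fin n) (Fin ρ) ℝ),
      IsCompactSVD M U s V := by
  classical
  have hA : (Mᵀ * M).IsHermitian := by
    simpa [Matrix.conjTranspose_eq_transpose_of_trivial] using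
      Matrix.isHermitian_conjTranspose_mul_self M
  let b : Fin n → Fin n → ℝ := fun j => (hA.eigenvectorBasis j).ofLp
  have hb : ∀ i j, b i ⬝ᵥ b j = if i = j then 1 else 0 := by
    intro i j
    have := hA.eigenvectorBasis.inner_eq_ite j i
    simp only [EuclideanSpace.inner_eq_star_dotProduct, star_trivial] at this
    rw [this]
    simp [eq_comm]
  have hev : ∀ j, (Mᵀ * M) *ᵥ b j = hA.eigenvalues j • b j := hA.mulVec_eigenvectorBasis
  have hdot : ∀ i j, (M *ᵥ b i) ⬝ᵥ (M *ᵥ b j) = if i = j then hA.eigenvalues j else 0 := by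
    intro i j
    have : (M *ᵥ b i) ⬝ᵥ (M *ᵥ b j) = b i ⬝ᵥ ((Mᵀ * M) *ᵥ b j) := by
      rw [← Matrix.mulVec_mulVec, Matrix.dotProduct_mulVec (b i), Matrix.vecMul_transpose]
    rw [this, hev, dotProduct_smul, hb]
    split_ifs <;> simp
  have hnn : ∀ j, 0 ≤ hA.eigenvalues j := fun j => by
    have h := hdot j j
    rw [if_pos rfl] at h
    rw [← h]
    exact Finset.sum_nonneg fun i _ => mul_self_nonneg _
  have hzero : ∀ j, ¬ 0 < hA.eigenvalues j → M *ᵥ b j = 0 := fun j hj => by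
    have h := hdot j j
    rw [if_pos rfl, le_antisymm (not_lt.1 hj) (hnn j)] at h
    exact dotProduct_self_eq_zero.1 h
  let e := Fintype.equivFin {j // 0 < hA.eigenvalues j}
  let g : Fin (Fintype.card {j // 0 < hA.eigenvalues j}) → Fin n := fun k => (e.symm k).1
  have hg : Function.Injective g := Subtype.val_injective.comp e.symm.injective
  have hpos : ∀ k, 0 < hA.eigenvalues (g k) := fun k => (e.symm k).2
  let s : Fin (Fintype.card {j // 0 < hA.eigenvalues j}) → ℝ := fun k => √(hA.eigenvalues (g k))
  have hs : ∀ k, 0 < s k := fun k => Real.sqrt_pos.2 (hpos k)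
  refine ⟨_, Matrix.of fun i k => (s k)⁻¹ * (M *ᵥ b (g k)) i, s,
    Matrix.of fun i k => b (g k) i, ?_, ?_, hs, ?_⟩
  · ext k l
    have : ∑ i, (s k)⁻¹ * (M *ᵥ b (g k)) i * ((s l)⁻¹ * (M *ᵥ b (g l)) i) =
        (s k)⁻¹ * (s l)⁻¹ * ((M *ᵥ b (g k)) ⬝ᵥ (M *ᵥ b (g l))) := by
      rw [dotProduct, Finset.mul_sum]
      exact Finset.sum_congr rfl fun i _ => by ring
    simp only [Matrix.mul_apply, Matrix.transpose_apply, Matrix.of_apply]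
    rw [this, hdot, Matrix.one_apply]
    by_cases hkl : k = l
    · subst hkl
      have h2 : hA.eigenvalues (g k) = s k * s k := (Real.mul_self_sqrt (hnn _)).symm
      have := (hs k).ne'
      rw [if_pos rfl, if_pos rfl, h2]
      field_simp
    · rw [if_neg (fun h => hkl (hg h)), if_neg hkl, mul_zero]
  · ext k l
    have := hb (g k) (g l)
    simp only [Matrix.mul_apply, Matrix.transpose_apply, Matrix.of_apply]
    rw [Matrix.one_apply]
    simpa [dotProduct, hg.eq_iff] using this
  · have hcols : ∀ i l, ∑ j, (M *ᵥ b j) i * b j l = M i l := by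
      intro i l
      have hB : ∀ a l, ∑ j, b j a * b j l = if a = l then 1 else 0 := by
        intro a l
        let Q : Matrix (Fin n) (Fin n) ℝ := Matrix.of b
        have h1 : Q * Qᵀ = 1 := by
          ext x y
          simpa [Matrix.mul_apply, dotProduct, Matrix.one_apply, Q] using hb x y
        have h2 : Qᵀ * Q = 1 := mul_eq_one_comm.1 h1
        have := congrFun (congrFun h2 a) l
        simpa [Matrix.mul_apply, Matrix.one_apply, Q] using this
      calc ∑ j, (M *ᵥ b j) i * b j l = ∑ j, ∑ a, M i a * (b j a * b j l) := by
            refine Finset.sum_congr rfl fun j _ => ?_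
            rw [Matrix.mulVec, dotProduct, Finset.sum_mul]
            exact Finset.sum_congr rfl fun a _ => by ring
        _ = ∑ a, M i a * ∑ j, b j a * b j l := by
            rw [Finset.sum_comm]
            simp_rw [Finset.mul_sum]
        _ = M i l := by simp [hB]
    ext i l
    rw [← hcols i l, Matrix.mul_apply]
    simp only [Matrix.mul_diagonal, Matrix.transpose_apply, Matrix.of_apply]
    have h3 : ∀ k, (s k)⁻¹ * (M *ᵥ b (g k)) i * s k * b (g k) l =
        (M *ᵥ b (g k)) i * b (g k) l := fun k => by
      have := (hs k).ne'
      field_simp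
    simp_rw [h3]
    rw [e.symm.sum_comp (fun x : {j // 0 < hA.eigenvalues j} => (M *ᵥ b x.1) i * b x.1 l)]
    rw [← Fintype.sum_subtype_add_sum_subtype (fun j => 0 < hA.eigenvalues j)
      (fun j => (M *ᵥ b j) i * b j l), add_eq_left]
    exact Finset.sum_eq_zero fun j _ => by simp [hzero j.1 j.2]

/-- The matrix sign `msign(M) = U * Vᵀ`, where `M = U * diag(s) * Vᵀ` is a compact singular value
decomposition. The choice of the decomposition is immaterial, see `msign_eq`; `msign 0 = 0`. -/
noncomputable def msign {m n : ℕ} (M : Matrix (Fin m) (Fin n) ℝ) : Matrix (Fin m) (Fin n) ℝ :=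
  (exists_isCompactSVD M).choose_spec.choose *
    (exists_isCompactSVD M).choose_spec.choose_spec.choose_spec.chooseᵀ

theorem msign_eq {m n ρ : ℕ} {M : Matrix (Fin m) (Fin n) ℝ} {U : Matrix (Fin m) (Fin ρ) ℝ}
    {s : Fin ρ → ℝ} {V : Matrix (Fin n) (Fin ρ) ℝ} (h : IsCompactSVD M U s V) :
    msign M = U * Vᵀ :=
  IsCompactSVD.polar_unique
    (exists_isCompactSVD M).choose_spec.choose_spec.choose_spec.choose_spec h

/-- The nuclear norm: the sum of the singular values. Mathlib's sequence of singular values of an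
`m × n` matrix vanishes from index `min m n` on. -/
noncomputable def nuclearNorm {m n : ℕ} (M : Matrix (Fin m) (Fin n) ℝ) : ℝ :=
  ∑ i ∈ Finset.range (min m n), (Matrix.toEuclideanLin M).singularValues i

/-- The Frobenius inner product. -/
def frobeniusInner {m n : ℕ} (A B : Matrix (Fin m) (Fin n) ℝ) : ℝ :=
  ∑ i, ∑ j, A i j * B i j

/-- The gradient of `f` with respect to the Frobenius inner product: the matrix of partial
derivatives. -/
noncomputable def matrixGradient {m n : ℕ} (f : Matrix (Fin m) (Fin n) ℝ → ℝ)
    (X : Matrix (Fin m) (Fin n) ℝ) : Matrix (Fin m) (Fin n) ℝ :=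
  Matrix.of fun i j => fderiv ℝ f X (Matrix.single i j 1)

/-- `f` is differentiable and
`f Y ≤ f X + ⟨∇ f X, Y - X⟩ + (L / 2) * ‖Y - X‖_F ^ 2` for all `X` and `Y`. -/
def IsSmoothObjective {m n : ℕ} (f : Matrix (Fin m) (Fin n) ℝ → ℝ) (L : ℝ) : Prop :=
  Differentiable ℝ f ∧ ∀ X Y : Matrix (Fin m) (Fin n) ℝ,
    f Y ≤ f X + frobeniusInner (matrixGradient f X) (Y - X) +
      L / 2 * frobeniusInner (Y - X) (Y - X)

/-- The smooth shrinkage map with threshold `c`. -/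
noncomputable def smoothShrinkage (c x : ℝ) : ℝ :=
  x * Real.exp (-|x| / c)

/-- The mixture `(1 - α) N(0, s ^ 2) + α Cauchy(0, g)` (for `0 ≤ α ≤ 1`). -/
noncomputable def gaussianCauchyMixture (α : ℝ) (s g : ℝ≥0) : Measure ℝ :=
  ENNReal.ofReal (1 - α) • gaussianReal 0 (s ^ 2) + ENNReal.ofReal α • cauchyMeasure 0 g

/-- Matrices carry the product (that is, Borel) `σ`-algebra of their entries. -/
instance matrixMeasurableSpace {m n : ℕ} : MeasurableSpace (Matrix (Fin m) (Fin n) ℝ) :=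
  MeasurableSpace.pi

/-- The mini-batch average `(1 / N) ∑ ℓ, φ (G + Ξ ℓ)`, with `φ` applied entry by entry. -/
noncomputable def clippedBatchMean {m n N : ℕ} (φ : ℝ → ℝ) (G : Matrix (Fin m) (Fin n) ℝ)
    (Ξ : Fin N → Matrix (Fin m) (Fin n) ℝ) : Matrix (Fin m) (Fin n) ℝ :=
  (N : ℝ)⁻¹ • ∑ l, (G + Ξ l).map φ

/-- The pre-clipped Muon iterates `X (k + 1) = X k - η * msign (Ḡ k)` started at `X₀`, where
`Ḡ k` is the processed mini-batch mean with the gradient at `X k` and the noise `Ξ k`. -/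
noncomputable def preClippedMuon {Ω : Type*} {m n N : ℕ} (f : Matrix (Fin m) (Fin n) ℝ → ℝ)
    (φ : ℝ → ℝ) (η : ℝ) (X₀ : Matrix (Fin m) (Fin n) ℝ)
    (Ξ : ℕ → Fin N → Ω → Matrix (Fin m) (Fin n) ℝ) : ℕ → Ω → Matrix (Fin m) (Fin n) ℝ
  | 0, _ => X₀
  | k + 1, ω =>
    preClippedMuon f φ η X₀ Ξ k ω -
      η • msign (clippedBatchMean φ (matrixGradient f (preClippedMuon f φ η X₀ Ξ k ω))
        fun l => Ξ k l ω)

/-!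
The argument compares one Muon step with the ideal step along `msign (∇ f (X k))`.

*Descent.* The nuclear norm is dual to the operator norm: `‖G‖_* = ⟨G, msign G⟩` and
`⟨b, msign A⟩ ≤ ⟨b, msign b⟩` for every `A`. With Cauchy–Schwarz and `‖msign A‖_F² ≤ r` this gives
`‖G‖_* ≤ ⟨G, msign b⟩ + 2 √r ‖b - G‖_F` (`nuclearNorm_le_frobeniusInner_msign_add`). Inserting it into
the smoothness inequality and telescoping bounds the sum of the `‖G k‖_*` pathwise by
`Δ / η + T L η r / 2` and the estimation errors `2 √r ‖Ḡ k - G k‖_F` (`sum_nuclearNorm_le`).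

*Estimation error at a fixed gradient.* Let `S = S_c`. Entry by entry, the mean square error is the
variance plus the squared bias. As `S` is `1`-Lipschitz and bounded by `c / e`, the variance is at
most `E min (ξ², (2c/e)²) ≤ v` (`integral_sq_smoothShrinkage_sub_le`). As `S` is odd and the noise is
symmetric, `E S(y + ξ) - y = E (S(y + ξ) - S(ξ) - y)`, and
`|S' - 1| ≤ min (2|·|/c, 2)` makes this a *relative* error: it is at most
`|y| (|y|/c + E min (2|ξ|/c, 2))` (`abs_integral_smoothShrinkage_sub_le`). The condition on `c`
makes the factor of `|y|` at most `1 / (4 √r)` (`relative_bias_le`). So the bias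
costs at most half of `‖G k‖_*`, which the left-hand side absorbs.

*Randomness of the gradient.* The iterate `X k` depends measurably on the noise of the earlier
iterations only (`measurable_preClippedMuon`), so `G k` is independent of the current noise and the
bound for fixed gradients can be integrated (`integral_comp_le_of_indepFun`). Measurability of `msign`
comes from the Newton–Schulz iteration, whose polynomial steps converge to it
(`tendsto_iterate_newtonSchulzStep`).
-/

open Filter Topology

/-! ### The Frobenius inner product, the matrix sign and the nuclear norm -/

theorem frobeniusInner_eq_trace {m n : ℕ} (A B : Matrix (Fin m) (Fin n) ℝ) :
    frobeniusInner A B = (Aᵀ * B).trace := by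
  rw [frobeniusInner, Finset.sum_comm]
  simp [Matrix.trace, Matrix.mul_apply]

theorem frobeniusInner_comm {m n : ℕ} (A B : Matrix (Fin m) (Fin n) ℝ) :
    frobeniusInner A B = frobeniusInner B A := by
  simp only [frobeniusInner, mul_comm]

theorem frobeniusInner_sub_left {m n : ℕ} (A B C : Matrix (Fin m) (Fin n) ℝ) :
    frobeniusInner (A - B) C = frobeniusInner A C - frobeniusInner B C := by
  simp only [frobeniusInner, Matrix.sub_apply, sub_mul, Finset.sum_sub_distrib]

theorem frobeniusInner_smul_right {m n : ℕ} (a : ℝ) (A B : Matrix (Fin m) (Fin n) ℝ) :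
    frobeniusInner A (a • B) = a * frobeniusInner A B := by
  simp only [frobeniusInner, Matrix.smul_apply, smul_eq_mul, Finset.mul_sum]
  exact Finset.sum_congr rfl fun i _ => Finset.sum_congr rfl fun j _ => by ring

theorem frobeniusInner_self_nonneg {m n : ℕ} (A : Matrix (Fin m) (Fin n) ℝ) :
    0 ≤ frobeniusInner A A :=
  Finset.sum_nonneg fun _ _ => Finset.sum_nonneg fun _ _ => mul_self_nonneg _

theorem abs_frobeniusInner_le {m n : ℕ} (A B : Matrix (Fin m) (Fin n) ℝ) :
    |frobeniusInner A B| ≤ √(frobeniusInner A A) * √(frobeniusInner B B) := by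
  rw [← Real.sqrt_mul (frobeniusInner_self_nonneg A), ← Real.sqrt_sq_eq_abs]
  refine Real.sqrt_le_sqrt ?_
  have h := Finset.sum_mul_sq_le_sq_mul_sq Finset.univ
    (fun p : Fin m × Fin n => A p.1 p.2) fun p => B p.1 p.2
  simpa only [Fintype.sum_prod_type, pow_two, frobeniusInner] using h

namespace IsCompactSVD

variable {m n ρ : ℕ} {M : Matrix (Fin m) (Fin n) ℝ} {U : Matrix (Fin m) (Fin ρ) ℝ}
  {s : Fin ρ → ℝ} {V : Matrix (Fin n) (Fin ρ) ℝ}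

/-- `Mᵀ * U * Vᵀ` is the positive semidefinite polar part `V * diag(s) * Vᵀ`. -/
theorem transpose_mul_polar (h : IsCompactSVD M U s V) :
    Mᵀ * (U * Vᵀ) = V * Matrix.diagonal s * Vᵀ := by
  have hT : Mᵀ = V * Matrix.diagonal s * Uᵀ := by
    rw [h.eq_mul]
    simp [Matrix.transpose_mul, Matrix.mul_assoc]
  calc Mᵀ * (U * Vᵀ) = V * Matrix.diagonal s * (Uᵀ * U) * Vᵀ := by
        rw [hT]; simp only [Matrix.mul_assoc]
    _ = _ := by rw [h.left_orthonormal, Matrix.mul_one]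

theorem frobeniusInner_polar (h : IsCompactSVD M U s V) :
    frobeniusInner M (U * Vᵀ) = ∑ i, s i := by
  rw [frobeniusInner_eq_trace, h.transpose_mul_polar, Matrix.trace_mul_comm, ← Matrix.mul_assoc,
    h.right_orthonormal, Matrix.one_mul, Matrix.trace_diagonal]

theorem frobeniusInner_polar_self (h : IsCompactSVD M U s V) :
    frobeniusInner (U * Vᵀ) (U * Vᵀ) = ρ := by
  have e : (U * Vᵀ)ᵀ * (U * Vᵀ) = V * (Uᵀ * U) * Vᵀ := by
    rw [Matrix.transpose_mul, Matrix.transpose_transpose]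
    simp only [Matrix.mul_assoc]
  rw [frobeniusInner_eq_trace, e, h.left_orthonormal, Matrix.mul_one, Matrix.trace_mul_comm,
    h.right_orthonormal, Matrix.trace_one, Fintype.card_fin]

theorem frobeniusInner_self (h : IsCompactSVD M U s V) :
    frobeniusInner M M = ∑ i, s i ^ 2 := by
  have e : Mᵀ * M = V * Matrix.diagonal s * (Uᵀ * U) * Matrix.diagonal s * Vᵀ := by
    rw [h.eq_mul]
    simp only [Matrix.transpose_mul, Matrix.transpose_transpose, Matrix.diagonal_transpose,
      Matrix.mul_assoc]
  rw [frobeniusInner_eq_trace, e, h.left_orthonormal, Matrix.mul_one, Matrix.mul_assoc V,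
    Matrix.diagonal_mul_diagonal, Matrix.trace_mul_comm, ← Matrix.mul_assoc,
    h.right_orthonormal, Matrix.one_mul, Matrix.trace_diagonal]
  simp [pow_two]

theorem le_min (h : IsCompactSVD M U s V) : ρ ≤ min m n := by
  have aux : ∀ {a : ℕ} (W : Matrix (Fin a) (Fin ρ) ℝ), Wᵀ * W = 1 → ρ ≤ a := by
    intro a W hW
    have h1 := Matrix.rank_transpose_mul_self W
    rw [hW, Matrix.rank_one, Fintype.card_fin] at h1
    exact h1 ▸ W.rank_le_height
  exact Nat.le_min.2 ⟨aux U h.left_orthonormal, aux V h.right_orthonormal⟩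

end IsCompactSVD

/-- Bessel's inequality: an orthonormal family has an orthogonal projection of norm at most `1`
onto the span of another one. -/
theorem sum_sq_transpose_mul_le_one {a ρ ρ' : ℕ} {U : Matrix (Fin a) (Fin ρ) ℝ}
    {W : Matrix (Fin a) (Fin ρ') ℝ} (hU : Uᵀ * U = 1) (hW : Wᵀ * W = 1) (i : Fin ρ) :
    ∑ k, (Uᵀ * W) i k ^ 2 ≤ 1 := by
  have key : (U - W * (Wᵀ * U))ᵀ * (U - W * (Wᵀ * U)) = 1 - (Uᵀ * W) * (Uᵀ * W)ᵀ := by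
    have e1 : Uᵀ * W * (Wᵀ * W) * (Wᵀ * U) = Uᵀ * W * (Wᵀ * U) := by rw [hW, Matrix.mul_one]
    simp only [Matrix.transpose_sub, Matrix.transpose_mul, Matrix.transpose_transpose,
      Matrix.sub_mul, Matrix.mul_sub, hU]
    simp only [Matrix.mul_assoc] at e1 ⊢
    rw [e1]
    abel
  have h := congrFun (congrFun key i) i
  have h0 : 0 ≤ ((U - W * (Wᵀ * U))ᵀ * (U - W * (Wᵀ * U))) i i := by
    rw [Matrix.mul_apply]
    exact Finset.sum_nonneg fun _ _ => mul_self_nonneg _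
  have h1 : ((Uᵀ * W) * (Uᵀ * W)ᵀ) i i = ∑ k, (Uᵀ * W) i k ^ 2 := by
    rw [Matrix.mul_apply]
    simp only [Matrix.transpose_apply, pow_two]
  rw [h, Matrix.sub_apply, Matrix.one_apply_eq, h1] at h0
  linarith

namespace IsCompactSVD

variable {m n ρ ρ' : ℕ} {M M' : Matrix (Fin m) (Fin n) ℝ} {U : Matrix (Fin m) (Fin ρ) ℝ}
  {s : Fin ρ → ℝ} {V : Matrix (Fin n) (Fin ρ) ℝ} {U' : Matrix (Fin m) (Fin ρ') ℝ}
  {s' : Fin ρ' → ℝ} {V' : Matrix (Fin n) (Fin ρ') ℝ}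

/-- The polar factor of any matrix has operator norm at most `1`, so pairing `M` with it gives at
most the sum of the singular values of `M`. -/
theorem frobeniusInner_polar_le (h : IsCompactSVD M U s V) (h' : IsCompactSVD M' U' s' V') :
    frobeniusInner M (U' * V'ᵀ) ≤ ∑ i, s i := by
  have e : frobeniusInner M (U' * V'ᵀ) =
      (Matrix.diagonal s * ((Uᵀ * U') * (Vᵀ * V')ᵀ)).trace := by
    rw [frobeniusInner_eq_trace, h.eq_mul]
    simp only [Matrix.transpose_mul, Matrix.transpose_transpose, Matrix.diagonal_transpose]
    rw [Matrix.mul_assoc, Matrix.trace_mul_comm]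
    simp only [Matrix.mul_assoc]
  rw [e, Matrix.trace]
  refine Finset.sum_le_sum fun i _ => ?_
  rw [Matrix.diag_apply, Matrix.diagonal_mul, Matrix.mul_apply]
  refine mul_le_of_le_one_right (h.pos i).le ?_
  have b1 := sum_sq_transpose_mul_le_one h.left_orthonormal h'.left_orthonormal i
  have b2 := sum_sq_transpose_mul_le_one h.right_orthonormal h'.right_orthonormal i
  calc ∑ k, (Uᵀ * U') i k * (Vᵀ * V')ᵀ k i
      ≤ ∑ k, ((Uᵀ * U') i k ^ 2 + (Vᵀ * V') i k ^ 2) / 2 := by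
        refine Finset.sum_le_sum fun k _ => ?_
        rw [Matrix.transpose_apply]
        nlinarith [sq_nonneg ((Uᵀ * U') i k - (Vᵀ * V') i k)]
    _ ≤ 1 := by
        rw [← Finset.sum_div, Finset.sum_add_distrib]
        linarith

end IsCompactSVD

theorem frobeniusInner_msign_self_le {m n : ℕ} (M : Matrix (Fin m) (Fin n) ℝ) :
    frobeniusInner (msign M) (msign M) ≤ (min m n : ℕ) := by
  obtain ⟨ρ, U, s, V, h⟩ := exists_isCompactSVD M
  rw [msign_eq h, h.frobeniusInner_polar_self]
  exact_mod_cast h.le_min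

/-- Among all matrix signs, that of `M` itself pairs best with `M`. -/
theorem frobeniusInner_msign_le {m n : ℕ} (M A : Matrix (Fin m) (Fin n) ℝ) :
    frobeniusInner M (msign A) ≤ frobeniusInner M (msign M) := by
  obtain ⟨ρ, U, s, V, h⟩ := exists_isCompactSVD M
  obtain ⟨ρ', U', s', V', h'⟩ := exists_isCompactSVD A
  rw [msign_eq h, msign_eq h', h.frobeniusInner_polar]
  exact h.frobeniusInner_polar_le h'

/-- The Frobenius norm is at most the nuclear norm, the latter written as `⟨M, msign M⟩`. -/
theorem sqrt_frobeniusInner_self_le {m n : ℕ} (M : Matrix (Fin m) (Fin n) ℝ) :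
    √(frobeniusInner M M) ≤ frobeniusInner M (msign M) := by
  obtain ⟨ρ, U, s, V, h⟩ := exists_isCompactSVD M
  rw [msign_eq h, h.frobeniusInner_polar, h.frobeniusInner_self]
  exact Real.sqrt_le_iff.2 ⟨Finset.sum_nonneg fun i _ => (h.pos i).le,
    Finset.sum_sq_le_sq_sum_of_nonneg fun i _ => (h.pos i).le⟩

/-- With `q` a polynomial interpolating `x ↦ 1 / √x` on the nonzero spectrum of `Mᵀ * M`, the polar
factor is `M * q (Mᵀ * M)`, so `⟨M, msign M⟩` is the trace of `Mᵀ * M * q (Mᵀ * M)`, which in an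
eigenbasis of `Mᵀ * M` is the sum of the square roots of the eigenvalues. -/
theorem nuclearNorm_eq_frobeniusInner_msign {m n : ℕ} (M : Matrix (Fin m) (Fin n) ℝ) :
    nuclearNorm M = frobeniusInner M (msign M) := by
  classical
  set T := Matrix.toEuclideanLin M with hTdef
  have hfin : Module.finrank ℝ (EuclideanSpace ℝ (Fin n)) = n := by simp
  set hs := T.isSymmetric_adjoint_comp_self
  set b := hs.eigenvectorBasis hfin
  set lam := hs.eigenvalues hfin
  have hcomp : (LinearMap.adjoint T) ∘ₗ T = Matrix.toEuclideanLin (Mᵀ * M) := by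
    rw [hTdef, ← Matrix.toEuclideanLin_conjTranspose_eq_adjoint,
      Matrix.conjTranspose_eq_transpose_of_trivial]
    ext x : 1
    simp [Matrix.toLpLin_apply]
  have hev : ∀ j, (Mᵀ * M) *ᵥ (b j).ofLp = lam j • (b j).ofLp := by
    intro j
    have h1 : (LinearMap.adjoint T ∘ₗ T) (b j) = lam j • b j :=
      hs.apply_eigenvectorBasis hfin j
    have h2 := LinearMap.congr_fun hcomp (b j)
    rw [h1, Matrix.toLpLin_apply] at h2
    simpa using (congrArg WithLp.ofLp h2).symm
  -- singular values with index at least `min m n` vanish, as the rank is at most `m`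
  have hrange : nuclearNorm M = ∑ j : Fin n, √(lam j) := by
    have h1 : nuclearNorm M = ∑ i ∈ Finset.range n, T.singularValues i := by
      refine Finset.sum_subset (Finset.range_mono (min_le_right m n)) fun i hi hi' => ?_
      rw [Finset.mem_range] at hi hi'
      rw [LinearMap.singularValues_eq_zero_iff_le_finrank_range]
      have := Submodule.finrank_le T.range
      rw [finrank_euclideanSpace, Fintype.card_fin] at this
      exact this.trans (not_lt.1 fun hlt => hi' (lt_min hlt hi))
    rw [h1, Finset.sum_range]
    exact Finset.sum_congr rfl fun j _ => T.singularValues_fin hfin j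
  obtain ⟨ρ, U, s, V, h⟩ := exists_isCompactSVD M
  let S : Finset ℝ := Finset.univ.image (fun i => s i ^ 2) ∪ Finset.univ.image lam
  let p : Polynomial ℝ := Lagrange.interpolate S id (fun x => (√x)⁻¹)
  have hp : ∀ x ∈ S, p.eval x = (√x)⁻¹ := fun x hx =>
    Lagrange.eval_interpolate_at_node (v := id) _ (Function.injective_id.injOn) hx
  have e1 : (fun i => s i * p.eval (s i ^ 2)) = fun _ => 1 := by
    funext i
    rw [hp _ (by simp [S]), Real.sqrt_sq (h.pos i).le, mul_inv_cancel₀ (h.pos i).ne']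
  have a := h.mul_aeval_gram p
  rw [e1, Matrix.diagonal_one, Matrix.mul_one] at a
  have hpow : ∀ (k : ℕ) j, ((Mᵀ * M) ^ k) *ᵥ (b j).ofLp = lam j ^ k • (b j).ofLp := by
    intro k j
    induction k with
    | zero => simp
    | succ k ih =>
      rw [pow_succ, ← Matrix.mulVec_mulVec, hev, Matrix.mulVec_smul, ih, smul_smul, pow_succ,
        mul_comm]
  have hpoly : ∀ (Q : Polynomial ℝ) j,
      (Polynomial.aeval (Mᵀ * M) Q) *ᵥ (b j).ofLp = Q.eval (lam j) • (b j).ofLp := by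
    intro Q j
    induction Q using Polynomial.induction_on' with
    | add P Q hP hQ => rw [map_add, Matrix.add_mulVec, hP, hQ, Polynomial.eval_add, add_smul]
    | monomial k x =>
      rw [Polynomial.aeval_monomial, ← Algebra.smul_def, Matrix.smul_mulVec, hpow, smul_smul,
        Polynomial.eval_monomial]
  rw [hrange, msign_eq h, frobeniusInner_eq_trace, ← a, ← Matrix.mul_assoc]
  have htr : (Mᵀ * M * Polynomial.aeval (Mᵀ * M) p).trace =
      LinearMap.trace ℝ _ (Matrix.toEuclideanLin (Mᵀ * M * Polynomial.aeval (Mᵀ * M) p)) := by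
    rw [Matrix.toEuclideanLin, Matrix.toLpLin_eq_toLin, Matrix.trace_toLin_eq]
  rw [htr, LinearMap.trace_eq_sum_inner _ b]
  refine Finset.sum_congr rfl fun j _ => ?_
  -- a zero eigenvalue gives `0 * p.eval 0 = 0 = √0`, in agreement with `Real.div_sqrt`
  have h3 : Matrix.toEuclideanLin (Mᵀ * M * Polynomial.aeval (Mᵀ * M) p) (b j) =
      √(lam j) • b j := by
    rw [Matrix.toLpLin_apply, ← Matrix.mulVec_mulVec, hpoly, Matrix.mulVec_smul, hev,
      smul_smul, hp _ (by simp [S]), WithLp.toLp_smul, WithLp.toLp_ofLp, mul_comm,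
      ← div_eq_mul_inv, Real.div_sqrt]
  rw [h3, inner_smul_right, real_inner_self_eq_norm_sq, b.orthonormal.1 j]
  simp

/-! ### Measurability of the matrix sign and of the gradient -/

/-- One step of the Newton–Schulz iteration for the matrix sign. -/
noncomputable def newtonSchulzStep {m n : ℕ} (X : Matrix (Fin m) (Fin n) ℝ) :
    Matrix (Fin m) (Fin n) ℝ :=
  (3 / 2 : ℝ) • X - (1 / 2 : ℝ) • (X * Xᵀ * X)

theorem continuous_newtonSchulzStep {m n : ℕ} :
    Continuous (newtonSchulzStep (m := m) (n := n)) := by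
  unfold newtonSchulzStep
  fun_prop

theorem newtonSchulzStep_mul_diagonal_mul {m n ρ : ℕ} {U : Matrix (Fin m) (Fin ρ) ℝ}
    {V : Matrix (Fin n) (Fin ρ) ℝ} (hU : Uᵀ * U = 1) (hV : Vᵀ * V = 1) (d : Fin ρ → ℝ) :
    newtonSchulzStep (U * Matrix.diagonal d * Vᵀ) =
      U * Matrix.diagonal (fun i => 3 / 2 * d i - 1 / 2 * d i ^ 3) * Vᵀ := by
  have e : U * Matrix.diagonal d * Vᵀ * (U * Matrix.diagonal d * Vᵀ)ᵀ *
      (U * Matrix.diagonal d * Vᵀ) = U * Matrix.diagonal (fun i => d i ^ 3) * Vᵀ := by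
    calc _ = U * Matrix.diagonal d * (Vᵀ * V) * Matrix.diagonal d * (Uᵀ * U) *
          Matrix.diagonal d * Vᵀ := by
            simp only [Matrix.transpose_mul, Matrix.transpose_transpose,
              Matrix.diagonal_transpose, Matrix.mul_assoc]
      _ = _ := by
        rw [hU, hV, Matrix.mul_one, Matrix.mul_one, Matrix.mul_assoc U,
          Matrix.diagonal_mul_diagonal, Matrix.mul_assoc U, Matrix.diagonal_mul_diagonal]
        congr 3
        funext i
        ring
  rw [newtonSchulzStep, e, ← Matrix.smul_mul, ← Matrix.mul_smul, ← Matrix.smul_mul,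
    ← Matrix.mul_smul, ← Matrix.sub_mul, ← Matrix.mul_sub, ← Matrix.diagonal_smul,
    ← Matrix.diagonal_smul, Matrix.diagonal_sub]
  rfl

theorem tendsto_iterate_newtonSchulz_scalar {x : ℝ} (h0 : 0 < x) (h1 : x ≤ 1) :
    Tendsto (fun k => (fun y : ℝ => 3 / 2 * y - 1 / 2 * y ^ 3)^[k] x) atTop (𝓝 1) := by
  have key : ∀ k, x ≤ (fun y : ℝ => 3 / 2 * y - 1 / 2 * y ^ 3)^[k] x ∧
      (fun y : ℝ => 3 / 2 * y - 1 / 2 * y ^ 3)^[k] x ≤ 1 ∧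
      1 - (1 - x / 2) ^ k ≤ (fun y : ℝ => 3 / 2 * y - 1 / 2 * y ^ 3)^[k] x := by
    intro k
    induction k with
    | zero => simp [h1, h0.le]
    | succ k ih =>
      rw [Function.iterate_succ_apply', pow_succ]
      set y := (fun y : ℝ => 3 / 2 * y - 1 / 2 * y ^ 3)^[k] x
      obtain ⟨a, b, c⟩ := ih
      have hy : 0 < y := h0.trans_le a
      refine ⟨?_, ?_, ?_⟩
      · nlinarith [mul_nonneg hy.le (mul_nonneg (sub_nonneg.2 b) (by linarith : 0 ≤ 1 + y))]
      · nlinarith [mul_nonneg (sq_nonneg (1 - y)) (by linarith : 0 ≤ 1 + y / 2)]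
      · -- `1 - p y = (1 - y) * (1 - y / 2 - y ^ 2 / 2)` for the Newton–Schulz polynomial `p`
        have e : 1 - (3 / 2 * y - 1 / 2 * y ^ 3) ≤ (1 - y) * (1 - x / 2) := by
          nlinarith [mul_nonneg (sub_nonneg.2 b) (by nlinarith : 0 ≤ y / 2 + y ^ 2 / 2 - x / 2)]
        have e2 : (1 - y) * (1 - x / 2) ≤ (1 - x / 2) ^ k * (1 - x / 2) :=
          mul_le_mul_of_nonneg_right (by linarith) (by linarith)
        change 1 - (1 - x / 2) ^ k * (1 - x / 2) ≤ 3 / 2 * y - 1 / 2 * y ^ 3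
        linarith
  have hlim : Tendsto (fun k : ℕ => 1 - (1 - x / 2) ^ k) atTop (𝓝 (1 - 0)) :=
    (tendsto_pow_atTop_nhds_zero_of_lt_one (by linarith) (by linarith)).const_sub 1
  rw [sub_zero] at hlim
  exact tendsto_of_tendsto_of_tendsto_of_le_of_le hlim tendsto_const_nhds
    (fun k => (key k).2.2) fun k => (key k).2.1

/-- The Newton–Schulz iteration, started at the matrix divided by its Frobenius norm, drives every
positive singular value to `1` and hence converges to the matrix sign. -/
theorem tendsto_iterate_newtonSchulzStep {m n : ℕ} (M : Matrix (Fin m) (Fin n) ℝ) (a : Fin m)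
    (b : Fin n) :
    Tendsto (fun k => newtonSchulzStep^[k] ((√(frobeniusInner M M))⁻¹ • M) a b) atTop
      (𝓝 (msign M a b)) := by
  obtain ⟨ρ, U, s, V, h⟩ := exists_isCompactSVD M
  have hs : ∀ i, s i ≤ √(frobeniusInner M M) := fun i => by
    rw [h.frobeniusInner_self]
    exact Real.le_sqrt_of_sq_le
      (Finset.single_le_sum (f := fun i => s i ^ 2) (fun _ _ => sq_nonneg _) (Finset.mem_univ i))
  set F := √(frobeniusInner M M)
  have hit : ∀ k, newtonSchulzStep^[k] (F⁻¹ • M) = U * Matrix.diagonal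
      (fun i => (fun y : ℝ => 3 / 2 * y - 1 / 2 * y ^ 3)^[k] (F⁻¹ * s i)) * Vᵀ := by
    intro k
    induction k with
    | zero =>
      rw [Function.iterate_zero, id, h.eq_mul, ← Matrix.smul_mul, ← Matrix.mul_smul,
        ← Matrix.diagonal_smul]
      rfl
    | succ k ih =>
      rw [Function.iterate_succ_apply', ih, newtonSchulzStep_mul_diagonal_mul
        h.left_orthonormal h.right_orthonormal]
      simp only [Function.iterate_succ_apply']
  have hsign : msign M a b = ∑ i, U a i * 1 * V b i := by
    rw [msign_eq h, Matrix.mul_apply]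
    simp [Matrix.transpose_apply]
  have hentry : ∀ k, newtonSchulzStep^[k] (F⁻¹ • M) a b = ∑ i, U a i *
      (fun y : ℝ => 3 / 2 * y - 1 / 2 * y ^ 3)^[k] (F⁻¹ * s i) * V b i := fun k => by
    rw [hit, Matrix.mul_apply]
    simp only [Matrix.mul_diagonal, Matrix.transpose_apply]
  rw [hsign]
  simp only [hentry]
  refine tendsto_finsetSum _ fun i _ => ((tendsto_iterate_newtonSchulz_scalar ?_ ?_).const_mul
    _).mul_const _
  · exact mul_pos (inv_pos.2 ((h.pos i).trans_le (hs i))) (h.pos i)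
  · rw [inv_mul_eq_div]
    exact div_le_one_of_le₀ (hs i) (Real.sqrt_nonneg _)

theorem measurable_frobeniusInner {α : Type*} [MeasurableSpace α] {m n : ℕ}
    {A B : α → Matrix (Fin m) (Fin n) ℝ} (hA : ∀ i j, Measurable fun x => A x i j)
    (hB : ∀ i j, Measurable fun x => B x i j) : Measurable fun x => frobeniusInner (A x) (B x) := by
  unfold frobeniusInner
  exact Finset.measurable_sum _ fun i _ => Finset.measurable_sum _ fun j _ =>
    (hA i j).mul (hB i j)

theorem measurable_matrix_entry {m n : ℕ} (i : Fin m) (j : Fin n) :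
    Measurable fun M : Matrix (Fin m) (Fin n) ℝ => M i j :=
  (measurable_pi_apply j).comp (measurable_pi_apply i)

theorem measurable_matrix_iff {α : Type*} [MeasurableSpace α] {m n : ℕ}
    {A : α → Matrix (Fin m) (Fin n) ℝ} : Measurable A ↔ ∀ i j, Measurable fun x => A x i j :=
  ⟨fun h i j => (measurable_matrix_entry i j).comp h,
    fun h => measurable_pi_lambda _ fun i => measurable_pi_lambda _ fun j => h i j⟩

/-- The product `σ`-algebra of the entries is the Borel `σ`-algebra of the product topology. -/
instance matrixBorelSpace {m n : ℕ} : BorelSpace (Matrix (Fin m) (Fin n) ℝ) :=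
  inferInstanceAs (BorelSpace (Fin m → Fin n → ℝ))

theorem measurable_msign {m n : ℕ} : Measurable (msign (m := m) (n := n)) := by
  rw [measurable_matrix_iff]
  intro a b
  refine measurable_of_tendsto_metrizable
    (f := fun k M => newtonSchulzStep^[k] ((√(frobeniusInner M M))⁻¹ • M) a b) (fun k => ?_)
    (tendsto_pi_nhds.2 fun M => tendsto_iterate_newtonSchulzStep M a b)
  have h1 : Measurable fun M : Matrix (Fin m) (Fin n) ℝ => (√(frobeniusInner M M))⁻¹ • M := by
    rw [measurable_matrix_iff]
    intro i j
    exact (measurable_frobeniusInner measurable_matrix_entry measurable_matrix_entry).sqrt.inv.mul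
      (measurable_matrix_entry i j)
  exact (measurable_matrix_entry a b).comp
    ((continuous_newtonSchulzStep.measurable.iterate k).comp h1)

theorem measurable_nuclearNorm {m n : ℕ} : Measurable (nuclearNorm (m := m) (n := n)) := by
  have : nuclearNorm (m := m) (n := n) = fun M => frobeniusInner M (msign M) :=
    funext nuclearNorm_eq_frobeniusInner_msign
  rw [this]
  exact measurable_frobeniusInner measurable_matrix_entry
    (measurable_matrix_iff.1 measurable_msign)

theorem measurable_matrixGradient {m n : ℕ} (f : Matrix (Fin m) (Fin n) ℝ → ℝ) :
    Measurable (matrixGradient f) := by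
  rw [measurable_matrix_iff]
  intro i j
  exact measurable_fderiv_apply_const (𝕜 := ℝ) (E := Fin m → Fin n → ℝ) (F := ℝ) f
    (Matrix.single i j 1)

/-! ### The smooth shrinkage map -/

theorem smoothShrinkage_neg (c x : ℝ) : smoothShrinkage c (-x) = -smoothShrinkage c x := by
  simp [smoothShrinkage]

theorem continuous_smoothShrinkage (c : ℝ) : Continuous (smoothShrinkage c) := by
  unfold smoothShrinkage
  fun_prop

theorem abs_smoothShrinkage_le {c : ℝ} (hc : 0 < c) (x : ℝ) :
    |smoothShrinkage c x| ≤ c / Real.exp 1 := by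
  have h1 : |x| / c ≤ Real.exp (|x| / c - 1) := by
    linarith [Real.add_one_le_exp (|x| / c - 1)]
  have h2 : |x| / c * Real.exp (-|x| / c) ≤ Real.exp (-1) := by
    refine (mul_le_mul_of_nonneg_right h1 (Real.exp_pos _).le).trans_eq ?_
    rw [← Real.exp_add]
    congr 1
    ring
  rw [smoothShrinkage, abs_mul, abs_of_pos (Real.exp_pos _), div_eq_mul_inv c, ← Real.exp_neg]
  calc |x| * Real.exp (-|x| / c) = c * (|x| / c * Real.exp (-|x| / c)) := by field_simp
    _ ≤ _ := mul_le_mul_of_nonneg_left h2 hc.le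

theorem hasDerivAt_smoothShrinkage (c x : ℝ) :
    HasDerivAt (smoothShrinkage c) ((1 - |x| / c) * Real.exp (-|x| / c)) x := by
  rcases eq_or_ne x 0 with rfl | hx
  · rw [hasDerivAt_iff_tendsto_slope_zero]
    have hcont : Tendsto (fun t : ℝ => Real.exp (-|t| / c)) (𝓝[≠] 0)
        (𝓝 ((1 - |(0 : ℝ)| / c) * Real.exp (-|(0 : ℝ)| / c))) := by
      have h : Continuous fun t : ℝ => Real.exp (-|t| / c) := by fun_prop
      simpa using (h.tendsto 0).mono_left nhdsWithin_le_nhds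
    refine hcont.congr' ?_
    filter_upwards [self_mem_nhdsWithin] with t ht
    have ht' : t ≠ 0 := ht
    simp [smoothShrinkage, ht']
  · have h1 : HasDerivAt (fun y : ℝ => -|y| / c) (-(SignType.sign x : ℝ) / c) x :=
      (hasDerivAt_abs hx).neg.div_const c
    refine ((hasDerivAt_id x).mul h1.exp).congr_deriv ?_
    have h2 : x * (SignType.sign x : ℝ) = |x| := by
      rw [mul_comm]; exact sign_mul_self x
    simp only [id]
    rw [show x * (Real.exp (-|x| / c) * (-(SignType.sign x : ℝ) / c)) =
      -(x * (SignType.sign x : ℝ)) * Real.exp (-|x| / c) / c by ring, h2]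
    ring

theorem abs_deriv_smoothShrinkage_le {c : ℝ} (hc : 0 < c) (x : ℝ) :
    |(1 - |x| / c) * Real.exp (-|x| / c)| ≤ 1 := by
  have ht : 0 ≤ |x| / c := by positivity
  have h1 := Real.add_one_le_exp (|x| / c)
  rw [abs_mul, abs_of_pos (Real.exp_pos _), neg_div, Real.exp_neg, ← div_eq_mul_inv,
    div_le_one (Real.exp_pos _), abs_le]
  constructor <;> linarith

theorem abs_deriv_smoothShrinkage_sub_one_le {c : ℝ} (hc : 0 < c) (x : ℝ) :
    |(1 - |x| / c) * Real.exp (-|x| / c) - 1| ≤ min (2 * |x| / c) 2 := by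
  have h := abs_le.1 (abs_deriv_smoothShrinkage_le hc x)
  rw [abs_sub_comm, abs_of_nonneg (by linarith [h.2])]
  refine le_min ?_ (by linarith [h.1])
  rw [mul_div_assoc, neg_div]
  have ht : 0 ≤ |x| / c := by positivity
  set t := |x| / c
  have h1 := Real.add_one_le_exp (-t)
  have h2 : Real.exp (-t) ≤ 1 := Real.exp_le_one_iff.2 (by linarith)
  rcases le_total t 1 with h3 | h3
  · nlinarith [mul_le_mul_of_nonneg_left h1 (sub_nonneg.2 h3), sq_nonneg t]
  · nlinarith [Real.exp_pos (-t)]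

theorem abs_smoothShrinkage_sub_le {c : ℝ} (hc : 0 < c) (x y : ℝ) :
    |smoothShrinkage c y - smoothShrinkage c x| ≤ |y - x| := by
  have h := convex_univ.norm_image_sub_le_of_norm_hasDerivWithin_le (f := smoothShrinkage c)
    (C := 1) (fun z _ => (hasDerivAt_smoothShrinkage c z).hasDerivWithinAt)
    (fun z _ => abs_deriv_smoothShrinkage_le hc z) (Set.mem_univ x) (Set.mem_univ y)
  simpa using h

/-- Integrating `|S' - 1| ≤ min (2 |·| / c) 2` along the segment from `x` to `x + g`: the average of
`2 t |g| / c` over `t ∈ [0, 1]` gives the term `|g| / c`. -/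
theorem abs_smoothShrinkage_add_sub_le {c : ℝ} (hc : 0 < c) (g x : ℝ) :
    |smoothShrinkage c (g + x) - smoothShrinkage c x - g| ≤
      |g| * (|g| / c + min (2 * |x| / c) 2) := by
  set M := min (2 * |x| / c) 2
  have hlin : ∀ t : ℝ, HasDerivAt (fun t : ℝ => x + t * g) g t := fun t => by
    simpa using ((hasDerivAt_id t).mul_const g).const_add x
  have hF : ∀ t : ℝ, HasDerivAt
      (fun t => smoothShrinkage c (x + t * g) - smoothShrinkage c x - t * g)
      ((1 - |x + t * g| / c) * Real.exp (-|x + t * g| / c) * g - g) t := fun t => by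
    have h1 := (hasDerivAt_smoothShrinkage c (x + t * g)).comp t (hlin t)
    have h2 : HasDerivAt (fun t : ℝ => t * g) g t := by
      simpa using (hasDerivAt_id t).mul_const g
    exact (h1.sub_const _).sub h2
  have hB : ∀ t : ℝ, HasDerivAt (fun t : ℝ => |g| * (t ^ 2 * |g| / c + M * t))
      (|g| * (2 * t * |g| / c + M)) t := fun t => by
    have h1 : HasDerivAt (fun t : ℝ => t ^ 2 * |g| / c) (2 * t * |g| / c) t := by
      simpa using ((hasDerivAt_pow 2 t).mul_const |g|).div_const c
    have h2 : HasDerivAt (fun t : ℝ => M * t) M t := by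
      simpa using (hasDerivAt_id t).const_mul M
    exact (h1.add h2).const_mul _
  have key := image_norm_le_of_norm_deriv_right_le_deriv_boundary (a := 0) (b := 1)
    (f := fun t : ℝ => smoothShrinkage c (x + t * g) - smoothShrinkage c x - t * g)
    (fun t _ => (hF t).continuousAt.continuousWithinAt)
    (fun t _ => (hF t).hasDerivWithinAt) (B := fun t : ℝ => |g| * (t ^ 2 * |g| / c + M * t))
    (by simp) hB ?_ (Set.right_mem_Icc.2 zero_le_one)
  · simpa [add_comm x g] using key
  · intro t ht
    have e : (1 - |x + t * g| / c) * Real.exp (-|x + t * g| / c) * g - g =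
        g * ((1 - |x + t * g| / c) * Real.exp (-|x + t * g| / c) - 1) := by ring
    rw [e, Real.norm_eq_abs, abs_mul]
    refine mul_le_mul_of_nonneg_left
      ((abs_deriv_smoothShrinkage_sub_one_le hc _).trans ?_) (abs_nonneg g)
    have h1 : |x + t * g| ≤ |x| + t * |g| := by
      refine (abs_add_le _ _).trans_eq ?_
      rw [abs_mul, abs_of_nonneg ht.1]
    have h2 : 0 ≤ 2 * t * |g| / c := by have := ht.1; positivity
    have h3 : 2 * |x + t * g| / c ≤ 2 * t * |g| / c + 2 * |x| / c := by
      rw [← add_div]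
      exact div_le_div_of_nonneg_right (by linarith) hc.le
    rw [← min_add_add_left]
    exact min_le_min h3 (by linarith)

/-! ### Truncated moments of the Gaussian–Cauchy mixture -/

theorem integral_cauchyMeasure {g : ℝ≥0} (hg : g ≠ 0) (h : ℝ → ℝ) :
    ∫ x, h x ∂cauchyMeasure 0 g = ∫ x, cauchyPDFReal 0 g x * h x := by
  rw [cauchyMeasure_of_scale_ne_zero 0 hg, integral_withDensity_eq_integral_toReal_smul
    (measurable_cauchyPDF 0 g) (ae_of_all _ fun x => ENNReal.ofReal_lt_top)]
  refine integral_congr_ae (ae_of_all _ fun x => ?_)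
  simp only [cauchyPDF, ENNReal.toReal_ofReal (cauchyPDF_pos 0 hg x).le, smul_eq_mul]

theorem cauchyPDFReal_zero_mul_sq_le {g : ℝ≥0} (hg : g ≠ 0) (x : ℝ) :
    cauchyPDFReal 0 g x * x ^ 2 ≤ g / Real.pi := by
  have hg' : (0 : ℝ) < g := by positivity
  have h1 : (x ^ 2 + (g : ℝ) ^ 2)⁻¹ * x ^ 2 ≤ 1 := by
    rw [inv_mul_eq_div]
    exact div_le_one_of_le₀ (by nlinarith) (by positivity)
  rw [cauchyPDFReal_def, sub_zero, mul_assoc]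
  calc Real.pi⁻¹ * g * ((x ^ 2 + (g : ℝ) ^ 2)⁻¹ * x ^ 2) ≤ Real.pi⁻¹ * g * 1 :=
        mul_le_mul_of_nonneg_left h1 (by positivity)
    _ = g / Real.pi := by ring

/-- The Cauchy integral of a bounded even function: majorize the integrand by `u` on `(0, a]`, and
use the density bound `g / (π x ^ 2)` on `(a, ∞)`, where the function is at most `K`. -/
theorem integral_abs_cauchyMeasure_le {g : ℝ≥0} (hg : g ≠ 0) {h u : ℝ → ℝ} (hh : Measurable h)
    {C : ℝ} (hC : ∀ x, |h x| ≤ C) {a K : ℝ} (ha : 0 < a) (hK : 0 ≤ K)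
    (hu : IntervalIntegrable u volume 0 a)
    (h1 : ∀ x, 0 < x → x ≤ a → cauchyPDFReal 0 g x * h x ≤ u x)
    (h2 : ∀ x, a < x → h x ≤ K) :
    ∫ x, h |x| ∂cauchyMeasure 0 g ≤ 2 * ((∫ x in (0 : ℝ)..a, u x) + g / Real.pi * K / a) := by
  have heven : ∀ x, cauchyPDFReal 0 g x * h |x| = (fun y => cauchyPDFReal 0 g y * h y) |x| := by
    intro x
    simp [cauchyPDFReal_def]
  rw [integral_cauchyMeasure hg, integral_congr_ae (ae_of_all _ heven)]
  refine (integral_comp_abs (f := fun y => cauchyPDFReal 0 g y * h y)).trans_le ?_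
  have hint : Integrable fun y => cauchyPDFReal 0 g y * h y :=
    (integrable_cauchyPDFReal 0).mul_bdd hh.aestronglyMeasurable (ae_of_all _ hC)
  refine mul_le_mul_of_nonneg_left ?_ zero_le_two
  rw [← Set.Ioc_union_Ioi_eq_Ioi ha.le, setIntegral_union Set.Ioc_disjoint_Ioi_same
    measurableSet_Ioi hint.integrableOn hint.integrableOn]
  refine add_le_add ?_ ?_
  · rw [intervalIntegral.integral_of_le ha.le]
    exact setIntegral_mono_on hint.integrableOn ((intervalIntegrable_iff_integrableOn_Ioc_of_le
      ha.le).1 hu) measurableSet_Ioc fun x hx => h1 x hx.1 hx.2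
  · have hpow : IntegrableOn (fun x : ℝ => x ^ (-2 : ℝ)) (Set.Ioi a) :=
      integrableOn_Ioi_rpow_of_lt (by norm_num) ha
    calc ∫ x in Set.Ioi a, cauchyPDFReal 0 g x * h x
        ≤ ∫ x in Set.Ioi a, g / Real.pi * K * x ^ (-2 : ℝ) := by
          refine setIntegral_mono_on hint.integrableOn (hpow.const_mul _) measurableSet_Ioi
            fun x hx => ?_
          have hx0 : 0 < x := ha.trans hx
          have e : x ^ (-2 : ℝ) = (x ^ 2)⁻¹ := by
            rw [Real.rpow_neg hx0.le]; norm_cast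
          rw [e]
          have hp : cauchyPDFReal 0 g x ≤ g / Real.pi * (x ^ 2)⁻¹ := by
            rw [← div_eq_mul_inv, le_div_iff₀ (by positivity)]
            exact cauchyPDFReal_zero_mul_sq_le hg x
          calc cauchyPDFReal 0 g x * h x ≤ cauchyPDFReal 0 g x * K :=
                mul_le_mul_of_nonneg_left (h2 x hx) (cauchyPDF_pos 0 hg x).le
            _ ≤ g / Real.pi * (x ^ 2)⁻¹ * K := mul_le_mul_of_nonneg_right hp hK
            _ = _ := by ring
      _ = g / Real.pi * K / a := by
          rw [integral_const_mul, integral_Ioi_rpow_of_lt (by norm_num) ha]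
          norm_num [Real.rpow_neg_one]
          ring

theorem integral_min_abs_cauchyMeasure_le {g : ℝ≥0} (hg : g ≠ 0) {c : ℝ} (hc : 0 < c) :
    ∫ x, min (2 * |x| / c) 2 ∂cauchyMeasure 0 g ≤
      2 * g / (Real.pi * c) * (Real.log (1 + (c / g) ^ 2) + 2) := by
  have hg' : (0 : ℝ) < g := by positivity
  have hden : ∀ x : ℝ, x ^ 2 + (g : ℝ) ^ 2 ≠ 0 := fun x => by positivity
  have hI : ∫ x in (0 : ℝ)..c, g / (Real.pi * c) * (2 * x / (x ^ 2 + g ^ 2)) =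
      g / (Real.pi * c) * Real.log (1 + (c / g) ^ 2) := by
    rw [intervalIntegral.integral_const_mul,
      intervalIntegral.integral_eq_sub_of_hasDerivAt (f := fun x : ℝ => Real.log (x ^ 2 + g ^ 2))]
    · rw [← Real.log_div (hden _) (hden _)]
      congr 2
      field_simp
      ring
    · intro x _
      have := ((hasDerivAt_pow 2 x).add_const ((g : ℝ) ^ 2)).log (hden x)
      simpa using this
    · exact Continuous.intervalIntegrable (by fun_prop (disch := exact hden _)) _ _
  have hm : ∀ x : ℝ, min (2 * |x| / c) 2 = (fun y => min (max (2 * y / c) 0) 2) |x| := by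
    intro x
    have : 0 ≤ 2 * |x| / c := by positivity
    simp [max_eq_left this]
  rw [integral_congr_ae (ae_of_all _ hm)]
  refine (integral_abs_cauchyMeasure_le hg (h := fun y => min (max (2 * y / c) 0) 2) (C := 2) (a := c) (K := 2)
    (u := fun x => g / (Real.pi * c) * (2 * x / (x ^ 2 + g ^ 2))) (by fun_prop) (fun x => ?_) hc
    zero_le_two (Continuous.intervalIntegrable (by fun_prop (disch := exact hden _)) _ _)
    (fun x hx _ => ?_) (fun x _ => min_le_right _ _)).trans_eq ?_
  · rw [abs_of_nonneg (le_min (le_max_right _ _) zero_le_two)]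
    exact min_le_right _ _
  · have hpos : 0 ≤ 2 * x / c := by positivity
    rw [max_eq_left hpos]
    calc cauchyPDFReal 0 g x * min (2 * x / c) 2 ≤ cauchyPDFReal 0 g x * (2 * x / c) :=
          mul_le_mul_of_nonneg_left (min_le_left _ _) (cauchyPDF_pos 0 hg x).le
      _ = _ := by
          rw [cauchyPDFReal_def, sub_zero]
          field_simp
  · rw [hI]
    field_simp

theorem integral_min_sq_cauchyMeasure_le {g : ℝ≥0} (hg : g ≠ 0) {a : ℝ} (ha : 0 < a) :
    ∫ x, min (x ^ 2) (a ^ 2) ∂cauchyMeasure 0 g ≤ 4 * g * a / Real.pi := by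
  have hm : ∀ x : ℝ, min (x ^ 2) (a ^ 2) = (fun y => min (y ^ 2) (a ^ 2)) |x| := by
    intro x
    simp
  rw [integral_congr_ae (ae_of_all _ hm)]
  refine (integral_abs_cauchyMeasure_le hg (h := fun y => min (y ^ 2) (a ^ 2)) (C := a ^ 2) (a := a) (K := a ^ 2)
    (u := fun x => g / Real.pi) (by fun_prop) (fun x => ?_) ha (by positivity) (by simp)
    (fun x hx _ => ?_) (fun x _ => min_le_right _ _)).trans_eq ?_
  · rw [abs_of_nonneg (by positivity)]
    exact min_le_right _ _
  · exact (mul_le_mul_of_nonneg_left (min_le_left _ _) (cauchyPDF_pos 0 hg x).le).trans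
      (cauchyPDFReal_zero_mul_sq_le hg x)
  · rw [intervalIntegral.integral_const]
    simp only [sub_zero, smul_eq_mul]
    field_simp
    ring

theorem integral_odd_cauchyMeasure {g : ℝ≥0} (hg : g ≠ 0) {h : ℝ → ℝ}
    (hodd : ∀ x, h (-x) = -h x) : ∫ x, h x ∂cauchyMeasure 0 g = 0 := by
  rw [integral_cauchyMeasure hg]
  have h1 := integral_neg_eq_self (fun x => cauchyPDFReal 0 g x * h x) volume
  have h2 : ∀ x, cauchyPDFReal 0 g (-x) * h (-x) = -(cauchyPDFReal 0 g x * h x) := fun x => by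
    rw [hodd, cauchyPDFReal_def, cauchyPDFReal_def]
    ring
  simp_rw [h2] at h1
  rw [integral_neg] at h1
  linarith

theorem integral_odd_gaussianReal (v : ℝ≥0) {h : ℝ → ℝ} (hh : Continuous h)
    (hodd : ∀ x, h (-x) = -h x) : ∫ x, h x ∂gaussianReal 0 v = 0 := by
  have h1 : ∫ x, h x ∂(gaussianReal 0 v).map (fun x => -x) = ∫ x, h (-x) ∂gaussianReal 0 v :=
    integral_map (by fun_prop) hh.aestronglyMeasurable
  rw [gaussianReal_map_neg, neg_zero] at h1
  simp_rw [hodd] at h1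
  rw [integral_neg] at h1
  linarith

theorem integral_sq_gaussianReal (s : ℝ≥0) :
    ∫ x, x ^ 2 ∂gaussianReal 0 (s ^ 2) = (s : ℝ) ^ 2 := by
  have h := variance_fun_id_gaussianReal (μ := 0) (v := s ^ 2)
  rw [variance_eq_integral measurable_id'.aemeasurable, integral_id_gaussianReal] at h
  simpa using h

theorem integral_abs_gaussianReal_le (s : ℝ≥0) :
    ∫ x, |x| ∂gaussianReal 0 (s ^ 2) ≤ s := by
  have hL : MemLp (fun x : ℝ => |x|) 2 (gaussianReal 0 (s ^ 2)) :=
    (memLp_id_gaussianReal 2).abs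
  have h := variance_nonneg (fun x : ℝ => |x|) (gaussianReal 0 (s ^ 2))
  rw [variance_eq_sub hL] at h
  simp only [Pi.pow_apply, sq_abs, integral_sq_gaussianReal] at h
  exact le_of_sq_le_sq (by linarith) s.2

section Mixture

variable {α : ℝ} {s g : ℝ≥0}

theorem isProbabilityMeasure_gaussianCauchyMixture (h0 : 0 ≤ α) (h1 : α ≤ 1) :
    IsProbabilityMeasure (gaussianCauchyMixture α s g) := by
  refine ⟨?_⟩
  simp only [gaussianCauchyMixture, Measure.add_apply, Measure.smul_apply, measure_univ,
    smul_eq_mul, mul_one]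
  rw [← ENNReal.ofReal_add (by linarith) h0]
  simp

theorem integral_gaussianCauchyMixture (h0 : 0 ≤ α) (h1 : α ≤ 1) {h : ℝ → ℝ} (hh : Continuous h)
    {C : ℝ} (hC : ∀ x, |h x| ≤ C) :
    ∫ x, h x ∂gaussianCauchyMixture α s g =
      (1 - α) * ∫ x, h x ∂gaussianReal 0 (s ^ 2) + α * ∫ x, h x ∂cauchyMeasure 0 g := by
  have hint : ∀ (ν : Measure ℝ) [IsProbabilityMeasure ν], Integrable h ν := fun ν _ =>
    Integrable.of_bound hh.aestronglyMeasurable C (ae_of_all _ hC)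
  rw [gaussianCauchyMixture, integral_add_measure
    ((hint _).smul_measure ENNReal.ofReal_ne_top) ((hint _).smul_measure ENNReal.ofReal_ne_top),
    integral_smul_measure, integral_smul_measure, ENNReal.toReal_ofReal (by linarith),
    ENNReal.toReal_ofReal h0, smul_eq_mul, smul_eq_mul]

theorem integral_smoothShrinkage_mixture (h0 : 0 ≤ α) (h1 : α ≤ 1) (hg : g ≠ 0) {c : ℝ}
    (hc : 0 < c) : ∫ x, smoothShrinkage c x ∂gaussianCauchyMixture α s g = 0 := by
  rw [integral_gaussianCauchyMixture h0 h1 (continuous_smoothShrinkage c)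
    (abs_smoothShrinkage_le hc), integral_odd_cauchyMeasure hg (smoothShrinkage_neg c),
    integral_odd_gaussianReal _ (continuous_smoothShrinkage c) (smoothShrinkage_neg c)]
  ring

theorem integral_min_abs_mixture_le (h0 : 0 ≤ α) (h1 : α ≤ 1) (hg : g ≠ 0) {c : ℝ}
    (hc : 0 < c) : ∫ x, min (2 * |x| / c) 2 ∂gaussianCauchyMixture α s g ≤
      (1 - α) * (2 * s / c) +
        α * (2 * g / (Real.pi * c) * (Real.log (1 + (c / g) ^ 2) + 2)) := by
  have hb : ∀ x : ℝ, |min (2 * |x| / c) 2| ≤ 2 := fun x => by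
    rw [abs_of_nonneg (by positivity)]
    exact min_le_right _ _
  have hcont : Continuous fun x : ℝ => min (2 * |x| / c) 2 := by fun_prop
  rw [integral_gaussianCauchyMixture h0 h1 hcont hb]
  refine add_le_add (mul_le_mul_of_nonneg_left ?_ (by linarith))
    (mul_le_mul_of_nonneg_left (integral_min_abs_cauchyMeasure_le hg hc) h0)
  have habs : Integrable (fun x : ℝ => |x|) (gaussianReal 0 (s ^ 2)) :=
    ((memLp_id_gaussianReal 1).integrable le_rfl).abs
  calc ∫ x, min (2 * |x| / c) 2 ∂gaussianReal 0 (s ^ 2)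
      ≤ ∫ x, 2 / c * |x| ∂gaussianReal 0 (s ^ 2) := by
        refine integral_mono (Integrable.of_bound hcont.aestronglyMeasurable 2 (ae_of_all _ hb))
          (habs.const_mul _) fun x => (min_le_left _ _).trans_eq ?_
        ring
    _ ≤ 2 * s / c := by
        rw [integral_const_mul, mul_div_right_comm]
        exact mul_le_mul_of_nonneg_left (integral_abs_gaussianReal_le s) (by positivity)

theorem integral_min_sq_mixture_le (h0 : 0 ≤ α) (h1 : α ≤ 1) (hg : g ≠ 0) {a : ℝ}
    (ha : 0 < a) : ∫ x, min (x ^ 2) (a ^ 2) ∂gaussianCauchyMixture α s g ≤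
      (1 - α) * (s : ℝ) ^ 2 + α * (4 * g * a / Real.pi) := by
  have hb : ∀ x : ℝ, |min (x ^ 2) (a ^ 2)| ≤ a ^ 2 := fun x => by
    rw [abs_of_nonneg (by positivity)]
    exact min_le_right _ _
  have hcont : Continuous fun x : ℝ => min (x ^ 2) (a ^ 2) := by fun_prop
  rw [integral_gaussianCauchyMixture h0 h1 hcont hb]
  refine add_le_add (mul_le_mul_of_nonneg_left ?_ (by linarith))
    (mul_le_mul_of_nonneg_left (integral_min_sq_cauchyMeasure_le hg ha) h0)
  rw [← integral_sq_gaussianReal]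
  exact integral_mono (Integrable.of_bound hcont.aestronglyMeasurable _ (ae_of_all _ hb))
    (memLp_id_gaussianReal 2).integrable_sq fun x => min_le_left _ _

/-- The mean of the shrunken noisy value differs from the clean value by a relative error only: the
mean of `S_c` under the symmetric noise law is `0`. -/
theorem abs_integral_smoothShrinkage_sub_le (h0 : 0 ≤ α) (h1 : α ≤ 1) (hg : g ≠ 0) {c : ℝ}
    (hc : 0 < c) (y : ℝ) :
    |∫ x, smoothShrinkage c (y + x) ∂gaussianCauchyMixture α s g - y| ≤
      |y| * (|y| / c + ((1 - α) * (2 * s / c) +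
        α * (2 * g / (Real.pi * c) * (Real.log (1 + (c / g) ^ 2) + 2)))) := by
  have := isProbabilityMeasure_gaussianCauchyMixture (s := s) (g := g) h0 h1
  set ν := gaussianCauchyMixture α s g
  have hi : ∀ y : ℝ, Integrable (fun x => smoothShrinkage c (y + x)) ν := fun y =>
    Integrable.of_bound ((continuous_smoothShrinkage c).comp
      (continuous_const.add continuous_id)).aestronglyMeasurable _
      (ae_of_all _ fun x => abs_smoothShrinkage_le hc _)
  have hi0 : Integrable (fun x => smoothShrinkage c x) ν := by simpa using hi 0
  have him : Integrable (fun x : ℝ => min (2 * |x| / c) 2) ν :=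
    Integrable.of_bound (by fun_prop) 2 (ae_of_all _ fun x => by
      rw [Real.norm_eq_abs, abs_of_nonneg (by positivity)]
      exact min_le_right _ _)
  have e : ∫ x, smoothShrinkage c (y + x) ∂ν - y =
      ∫ x, (smoothShrinkage c (y + x) - smoothShrinkage c x - y) ∂ν := by
    have e1 := integral_sub ((hi y).sub hi0) (integrable_const (μ := ν) y)
    simp only [Pi.sub_apply] at e1
    rw [e1, integral_sub (hi y) hi0, integral_smoothShrinkage_mixture h0 h1 hg hc]
    simp
  rw [e]
  calc |∫ x, (smoothShrinkage c (y + x) - smoothShrinkage c x - y) ∂ν|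
      ≤ ∫ x, |smoothShrinkage c (y + x) - smoothShrinkage c x - y| ∂ν :=
        abs_integral_le_integral_abs
    _ ≤ ∫ x, |y| * (|y| / c + min (2 * |x| / c) 2) ∂ν :=
        integral_mono (((hi y).sub hi0).sub (integrable_const _)).abs
          (((integrable_const _).add him).const_mul _)
          fun x => abs_smoothShrinkage_add_sub_le hc y x
    _ ≤ _ := by
        rw [integral_const_mul, integral_add (integrable_const _) him]
        refine mul_le_mul_of_nonneg_left ?_ (abs_nonneg y)
        simpa using integral_min_abs_mixture_le h0 h1 hg hc

/-- `S_c` is `1`-Lipschitz with values in `[-c / e, c / e]`, so the mean square deviation is governed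
by the noise truncated at `2 c / e`. -/
theorem integral_sq_smoothShrinkage_sub_le (h0 : 0 ≤ α) (h1 : α ≤ 1) (hg : g ≠ 0) {c : ℝ}
    (hc : 0 < c) (y : ℝ) :
    ∫ x, (smoothShrinkage c (y + x) - smoothShrinkage c y) ^ 2 ∂gaussianCauchyMixture α s g ≤
      (1 - α) * (s : ℝ) ^ 2 + 8 * α * g * c / (Real.pi * Real.exp 1) := by
  have := isProbabilityMeasure_gaussianCauchyMixture (s := s) (g := g) h0 h1
  set ν := gaussianCauchyMixture α s g
  have hc' : 0 < 2 * (c / Real.exp 1) := by positivity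
  -- `2 c / e` is the diameter of the range of `S_c`
  have hpt : ∀ x, (smoothShrinkage c (y + x) - smoothShrinkage c y) ^ 2 ≤
      min (x ^ 2) ((2 * (c / Real.exp 1)) ^ 2) := by
    intro x
    refine le_min (sq_le_sq.2 ?_) (sq_le_sq.2 ?_)
    · simpa using abs_smoothShrinkage_sub_le hc y (y + x)
    · rw [abs_of_pos hc']
      refine (abs_sub _ _).trans ?_
      linarith [abs_smoothShrinkage_le hc (y + x), abs_smoothShrinkage_le hc y]
  have hm := integral_min_sq_mixture_le (s := s) h0 h1 hg hc'
  have hcont : Continuous fun x => (smoothShrinkage c (y + x) - smoothShrinkage c y) ^ 2 :=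
    (((continuous_smoothShrinkage c).comp (continuous_const.add continuous_id)).sub
      continuous_const).pow 2
  calc _ ≤ ∫ x, min (x ^ 2) ((2 * (c / Real.exp 1)) ^ 2) ∂ν := by
        refine integral_mono (Integrable.of_bound hcont.aestronglyMeasurable
          ((2 * (c / Real.exp 1)) ^ 2) (ae_of_all _ fun x => ?_))
          (Integrable.of_bound (by fun_prop) ((2 * (c / Real.exp 1)) ^ 2)
            (ae_of_all _ fun x => ?_)) hpt
        · rw [Real.norm_eq_abs, abs_of_nonneg (sq_nonneg _)]
          exact (hpt x).trans (min_le_right _ _)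
        · rw [Real.norm_eq_abs, abs_of_nonneg (by positivity)]
          exact min_le_right _ _
    _ ≤ _ := hm
    _ = _ := by
        field_simp
        ring

end Mixture

/-! ### Bias and variance of the mini-batch mean -/

/-- The logarithm in the threshold: if `z = y / A ≥ log (e + A)` then `A ≤ exp z`, so
`log (1 + y ^ 2) ≤ log (2 * exp (2 * z) * z ^ 2) ≤ 4 * z - 1`. -/
theorem mul_log_one_add_sq_le {A y : ℝ} (hA : 0 ≤ A) (hy : 0 < y)
    (h : A * Real.log (Real.exp 1 + A) ≤ y) : 3 / 16 * A * (Real.log (1 + y ^ 2) + 2) ≤ y := by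
  rcases hA.eq_or_lt with rfl | hA
  · simpa using hy.le
  set z := y / A
  have hyz : y = A * z := by simp only [z]; field_simp
  have hz : Real.log (Real.exp 1 + A) ≤ z := by rwa [le_div_iff₀ hA, mul_comm]
  have hz1 : 1 ≤ z := by
    refine le_trans ?_ hz
    rw [Real.le_log_iff_exp_le (by positivity)]
    linarith
  have hAz : A ≤ Real.exp z := by
    have := (Real.log_le_iff_le_exp (by positivity)).1 hz
    linarith [Real.exp_pos 1]
  have hlog : Real.log (1 + y ^ 2) ≤ 4 * z - 1 := by
    have h1 : 1 + y ^ 2 ≤ 2 * (Real.exp z * z) ^ 2 := by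
      have h2 : y ≤ Real.exp z * z := by
        rw [hyz]; exact mul_le_mul_of_nonneg_right hAz (by linarith)
      have h3 : 1 ≤ Real.exp z * z := by
        nlinarith [Real.add_one_le_exp z]
      nlinarith
    refine (Real.log_le_log (by positivity) h1).trans ?_
    rw [Real.log_mul (by norm_num) (by positivity), Real.log_pow, Real.log_mul (by positivity)
      (by positivity), Real.log_exp]
    have h4 := Real.log_le_sub_one_of_pos (show (0 : ℝ) < 2 by norm_num)
    have h5 := Real.log_le_sub_one_of_pos (show (0 : ℝ) < z by linarith)
    push_cast
    linarith
  nlinarith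

/-- The threshold `c` makes the relative bias at most `1 / (4 √r)`. Since `3 / 2 ≤ √(8 / π)`, the
Gaussian part and the magnitude of the clean value use at most `1 / (6 √r)`; the Cauchy part uses
at most `1 / (12 √r)`. -/
theorem relative_bias_le {r α σ γ B c s g : ℝ} (hr : 0 < r) (hα₀ : 0 ≤ α) (hα₁ : α ≤ 1)
    (hB : 0 ≤ B) (hs : 0 ≤ s) (hsσ : s ≤ σ) (hg : 0 < g) (hgγ : g ≤ γ) (hc0 : 0 < c)
    (hc1 : 8 * √r * (B + √(8 / Real.pi) * (1 - α) * σ) ≤ c)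
    (hc2 : 128 * α * γ * √r / Real.pi *
      Real.log (Real.exp 1 + 128 * α * √r / Real.pi) ≤ c) :
    B / c + ((1 - α) * (2 * s / c) +
      α * (2 * g / (Real.pi * c) * (Real.log (1 + (c / g) ^ 2) + 2))) ≤ 1 / (4 * √r) := by
  have hR : 0 < √r := Real.sqrt_pos.2 hr
  have hπ := Real.pi_pos
  have hsq : 3 / 2 ≤ √(8 / Real.pi) := by
    refine Real.le_sqrt_of_sq_le ?_
    rw [le_div_iff₀ hπ]
    linarith [Real.pi_lt_d2]
  have p1 : B / c + (1 - α) * (2 * s / c) ≤ 1 / (6 * √r) := by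
    have e : B / c + (1 - α) * (2 * s / c) = (B + 2 * (1 - α) * s) / c := by ring
    rw [e, div_le_div_iff₀ hc0 (by positivity)]
    have h1 : (1 - α) * s ≤ (1 - α) * σ := mul_le_mul_of_nonneg_left hsσ (by linarith)
    have h0 : 0 ≤ (1 - α) * s := mul_nonneg (by linarith) hs
    have h2 : 3 / 2 * ((1 - α) * s) ≤ √(8 / Real.pi) * (1 - α) * σ := by
      rw [mul_assoc]
      exact mul_le_mul hsq h1 h0 (Real.sqrt_nonneg _)
    have h3 : (B + 2 * (1 - α) * s) * (6 * √r) ≤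
        8 * √r * (B + √(8 / Real.pi) * (1 - α) * σ) := by
      have : 6 * (B + 2 * (1 - α) * s) ≤ 8 * (B + √(8 / Real.pi) * (1 - α) * σ) := by linarith
      nlinarith
    linarith
  have p2 : α * (2 * g / (Real.pi * c) * (Real.log (1 + (c / g) ^ 2) + 2)) ≤ 1 / (12 * √r) := by
    set A := 128 * α * √r / Real.pi with hAdef
    have hA : 0 ≤ A := by positivity
    have hl : 0 ≤ Real.log (Real.exp 1 + A) :=
      Real.log_nonneg (by linarith [Real.add_one_le_exp 1])
    have h1 : A * Real.log (Real.exp 1 + A) ≤ c / g := by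
      rw [le_div_iff₀ hg]
      refine le_trans ?_ hc2
      have e : 128 * α * γ * √r / Real.pi = A * γ := by rw [hAdef]; ring
      rw [e]
      nlinarith [mul_le_mul_of_nonneg_left hgγ (mul_nonneg hA hl)]
    have h2 := mul_log_one_add_sq_le hA (div_pos hc0 hg) h1
    have e : α * (2 * g / (Real.pi * c) * (Real.log (1 + (c / g) ^ 2) + 2)) =
        (3 / 16 * A * (Real.log (1 + (c / g) ^ 2) + 2)) * (g / c) * (1 / (12 * √r)) := by
      rw [hAdef]
      field_simp
      ring
    rw [e]
    refine mul_le_of_le_one_left (by positivity) ?_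
    calc _ ≤ c / g * (g / c) := mul_le_mul_of_nonneg_right h2 (by positivity)
      _ = 1 := by field_simp
  have e : 1 / (4 * √r) = 1 / (6 * √r) + 1 / (12 * √r) := by
    field_simp
    norm_num
  rw [e]
  linarith

section BatchMean

variable {m n N : ℕ}

theorem clippedBatchMean_apply (φ : ℝ → ℝ) (G : Matrix (Fin m) (Fin n) ℝ)
    (ξ : Fin N → Matrix (Fin m) (Fin n) ℝ) (i : Fin m) (j : Fin n) :
    clippedBatchMean φ G ξ i j = (N : ℝ)⁻¹ * ∑ l, φ (G i j + ξ l i j) := by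
  simp [clippedBatchMean, Matrix.sum_apply]

variable {Ω : Type*} [MeasurableSpace Ω] {μ : Measure Ω} [IsProbabilityMeasure μ]

/-- Bias–variance decomposition of the mean of `N` independent shrunken observations of `y`. -/
theorem integral_sq_mean_smoothShrinkage_sub_le {α : ℝ} {s g : ℝ≥0} (h0 : 0 ≤ α) (h1 : α ≤ 1)
    (hg : g ≠ 0) {c : ℝ} (hc : 0 < c) (hN : 0 < N) {x : Fin N → Ω → ℝ}
    (hx : ∀ l, Measurable (x l)) (hind : Pairwise fun l l' => IndepFun (x l) (x l') μ)
    (hlaw : ∀ l, μ.map (x l) = gaussianCauchyMixture α s g) (y : ℝ) :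
    ∫ ω, ((N : ℝ)⁻¹ * ∑ l, smoothShrinkage c (y + x l ω) - y) ^ 2 ∂μ ≤
      ((1 - α) * (s : ℝ) ^ 2 + 8 * α * g * c / (Real.pi * Real.exp 1)) / N +
        (∫ t, smoothShrinkage c (y + t) ∂gaussianCauchyMixture α s g - y) ^ 2 := by
  have hNpos : (0 : ℝ) < N := by exact_mod_cast hN
  have hScont : Continuous fun t => smoothShrinkage c (y + t) :=
    (continuous_smoothShrinkage c).comp (continuous_const.add continuous_id)
  have hSm : ∀ l, Measurable fun ω => smoothShrinkage c (y + x l ω) := fun l =>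
    hScont.measurable.comp (hx l)
  have hL : ∀ l, MemLp (fun ω => smoothShrinkage c (y + x l ω)) 2 μ := fun l =>
    MemLp.of_bound (hSm l).aestronglyMeasurable (c / Real.exp 1)
      (ae_of_all _ fun ω => abs_smoothShrinkage_le hc _)
  have hmean : ∀ l, ∫ ω, smoothShrinkage c (y + x l ω) ∂μ =
      ∫ t, smoothShrinkage c (y + t) ∂gaussianCauchyMixture α s g := fun l => by
    rw [← hlaw l, integral_map (hx l).aemeasurable hScont.aestronglyMeasurable]
  have hvar : ∀ l, Var[fun ω => smoothShrinkage c (y + x l ω); μ] ≤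
      (1 - α) * (s : ℝ) ^ 2 + 8 * α * g * c / (Real.pi * Real.exp 1) := fun l => by
    have hcont : Continuous fun t => (smoothShrinkage c (y + t) - smoothShrinkage c y) ^ 2 :=
      (hScont.sub continuous_const).pow 2
    have h2 := integral_sq_smoothShrinkage_sub_le (s := s) h0 h1 hg hc y
    rw [← hlaw l, integral_map (hx l).aemeasurable hcont.aestronglyMeasurable] at h2
    refine le_trans ?_ h2
    rw [← variance_sub_const (hSm l).aestronglyMeasurable (smoothShrinkage c y)]
    exact variance_le_expectation_sq ((hSm l).sub_const _).aestronglyMeasurable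
  set Y : Ω → ℝ := fun ω => (N : ℝ)⁻¹ * ∑ l, smoothShrinkage c (y + x l ω)
  have hsumL : MemLp (∑ l, fun ω => smoothShrinkage c (y + x l ω)) 2 μ :=
    memLp_finsetSum' _ fun l _ => hL l
  have hYeq : Y = fun ω => (N : ℝ)⁻¹ * (∑ l, fun ω => smoothShrinkage c (y + x l ω)) ω := by
    funext ω
    simp [Y]
  have hYL : MemLp Y 2 μ := by
    rw [hYeq]
    exact hsumL.const_mul _
  have hYmean : ∫ ω, Y ω ∂μ = ∫ t, smoothShrinkage c (y + t) ∂gaussianCauchyMixture α s g := by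
    simp only [Y]
    rw [integral_const_mul, integral_finsetSum _ fun l _ => (hL l).integrable one_le_two]
    simp only [hmean, Finset.sum_const, Finset.card_univ, Fintype.card_fin, nsmul_eq_mul]
    field_simp
  have hYvar : Var[Y; μ] ≤
      ((1 - α) * (s : ℝ) ^ 2 + 8 * α * g * c / (Real.pi * Real.exp 1)) / N := by
    rw [hYeq, variance_const_mul, IndepFun.variance_sum (fun l _ => hL l)
      fun l _ l' _ hll => (hind hll).comp hScont.measurable hScont.measurable]
    have h3 := Finset.sum_le_sum fun l (_ : l ∈ Finset.univ) => hvar l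
    simp only [Finset.sum_const, Finset.card_univ, Fintype.card_fin, nsmul_eq_mul] at h3
    refine (mul_le_mul_of_nonneg_left h3 (by positivity)).trans_eq ?_
    field_simp
  have hYsub : MemLp (fun ω => Y ω - y) 2 μ := hYL.sub (memLp_const y)
  have hdec := variance_eq_sub hYsub
  rw [variance_sub_const hYL.aestronglyMeasurable, integral_sub (hYL.integrable one_le_two)
    (integrable_const _), hYmean] at hdec
  simp only [Pi.pow_apply, integral_const, probReal_univ, one_smul] at hdec
  change ∫ ω, (Y ω - y) ^ 2 ∂μ ≤ _
  linarith

theorem abs_clippedBatchMean_le {c : ℝ} (hc : 0 < c) (hN : 0 < N)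
    (G : Matrix (Fin m) (Fin n) ℝ) (ξ : Fin N → Matrix (Fin m) (Fin n) ℝ) (i : Fin m)
    (j : Fin n) : |clippedBatchMean (smoothShrinkage c) G ξ i j| ≤ c / Real.exp 1 := by
  have hNpos : (0 : ℝ) < N := by exact_mod_cast hN
  rw [clippedBatchMean_apply, abs_mul, abs_of_pos (inv_pos.2 hNpos), inv_mul_le_iff₀ hNpos]
  refine (Finset.abs_sum_le_sum_abs _ _).trans
    ((Finset.sum_le_sum fun l _ => abs_smoothShrinkage_le hc _).trans_eq ?_)
  simp

theorem sqrt_frobeniusInner_self_le_of_abs_le {A : Matrix (Fin m) (Fin n) ℝ} {b : ℝ}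
    (h : ∀ i j, |A i j| ≤ b) : √(frobeniusInner A A) ≤ √(m * n * b ^ 2) := by
  refine Real.sqrt_le_sqrt ?_
  calc frobeniusInner A A ≤ ∑ _i : Fin m, ∑ _j : Fin n, b ^ 2 := by
        refine Finset.sum_le_sum fun i _ => Finset.sum_le_sum fun j _ => ?_
        rw [← pow_two, ← sq_abs]
        exact pow_le_pow_left₀ (abs_nonneg _) (h i j) 2
    _ = m * n * b ^ 2 := by simp [mul_assoc]

theorem measurable_clippedBatchMean {φ : ℝ → ℝ} (hφ : Measurable φ) :
    Measurable fun p : Matrix (Fin m) (Fin n) ℝ × (Fin N → Matrix (Fin m) (Fin n) ℝ) =>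
      clippedBatchMean φ p.1 p.2 := by
  rw [measurable_matrix_iff]
  intro i j
  simp only [clippedBatchMean_apply]
  refine (Finset.measurable_sum _ fun l _ => hφ.comp ?_).const_mul _
  exact ((measurable_matrix_entry i j).comp measurable_fst).add
    ((measurable_matrix_entry i j).comp ((measurable_pi_apply l).comp measurable_snd))

/-- The expected Frobenius error of the mini-batch mean at a fixed gradient `G`. -/
theorem integral_sqrt_frobeniusInner_batchMean_sub_le {α : ℝ} {s g : ℝ≥0} (h0 : 0 ≤ α)
    (h1 : α ≤ 1) (hg : g ≠ 0) {c : ℝ} (hc : 0 < c) (hN : 0 < N)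
    {ξ : Fin N → Ω → Matrix (Fin m) (Fin n) ℝ} (hξ : ∀ l, Measurable (ξ l))
    (hind : Pairwise fun l l' => IndepFun (ξ l) (ξ l') μ)
    (hlaw : ∀ l i j, μ.map (fun ω => ξ l ω i j) = gaussianCauchyMixture α s g)
    {v δ : ℝ} (hv : (1 - α) * (s : ℝ) ^ 2 + 8 * α * g * c / (Real.pi * Real.exp 1) ≤ v)
    (hδ : 0 ≤ δ) (G : Matrix (Fin m) (Fin n) ℝ)
    (hbias : ∀ i j, |∫ t, smoothShrinkage c (G i j + t) ∂gaussianCauchyMixture α s g - G i j| ≤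
      |G i j| * δ) :
    ∫ ω, √(frobeniusInner (clippedBatchMean (smoothShrinkage c) G (fun l => ξ l ω) - G)
        (clippedBatchMean (smoothShrinkage c) G (fun l => ξ l ω) - G)) ∂μ ≤
      √(m * n * (v / N)) + δ * √(frobeniusInner G G) := by
  have hNpos : (0 : ℝ) < N := by exact_mod_cast hN
  set E : Ω → Matrix (Fin m) (Fin n) ℝ := fun ω =>
    clippedBatchMean (smoothShrinkage c) G (fun l => ξ l ω) - G
  have hEm : ∀ i j, Measurable fun ω => E ω i j := fun i j => by
    have h2 : Measurable fun ω => (G, fun l => ξ l ω) :=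
      measurable_const.prodMk (measurable_pi_lambda _ hξ)
    exact (measurable_matrix_iff.1 ((measurable_clippedBatchMean
      (continuous_smoothShrinkage c).measurable).comp h2) i j).sub_const _
  have hEb : ∀ ω i j, |E ω i j| ≤ c / Real.exp 1 + ∑ i, ∑ j, |G i j| := fun ω i j => by
    refine (abs_sub _ _).trans (add_le_add (abs_clippedBatchMean_le hc hN G _ i j) ?_)
    exact (Finset.single_le_sum (f := fun j => |G i j|) (fun _ _ => abs_nonneg _)
      (Finset.mem_univ j)).trans (Finset.single_le_sum (f := fun i => ∑ j, |G i j|)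
        (fun _ _ => Finset.sum_nonneg fun _ _ => abs_nonneg _) (Finset.mem_univ i))
  have hFm : Measurable fun ω => √(frobeniusInner (E ω) (E ω)) :=
    (measurable_frobeniusInner hEm hEm).sqrt
  have hFL : MemLp (fun ω => √(frobeniusInner (E ω) (E ω))) 2 μ :=
    MemLp.of_bound hFm.aestronglyMeasurable _ (ae_of_all _ fun ω => by
      rw [Real.norm_eq_abs, abs_of_nonneg (Real.sqrt_nonneg _)]
      exact sqrt_frobeniusInner_self_le_of_abs_le (hEb ω))
  -- Jensen's inequality `(E ‖E‖_F)² ≤ E ‖E‖_F²` as nonnegativity of a variance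
  have hjensen := variance_nonneg (fun ω => √(frobeniusInner (E ω) (E ω))) μ
  rw [variance_eq_sub hFL] at hjensen
  simp only [Pi.pow_apply, Real.sq_sqrt (frobeniusInner_self_nonneg _)] at hjensen
  have hEsq : ∀ i j, Integrable (fun ω => E ω i j * E ω i j) μ := fun i j =>
    Integrable.of_bound ((hEm i j).mul (hEm i j)).aestronglyMeasurable
      ((c / Real.exp 1 + ∑ i, ∑ j, |G i j|) * (c / Real.exp 1 + ∑ i, ∑ j, |G i j|))
      (ae_of_all _ fun ω => by
        rw [Real.norm_eq_abs, abs_mul]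
        exact mul_self_le_mul_self (abs_nonneg _) (hEb ω i j))
  have hsecond : ∫ ω, frobeniusInner (E ω) (E ω) ∂μ ≤
      m * n * (v / N) + δ ^ 2 * frobeniusInner G G := by
    simp only [frobeniusInner]
    rw [integral_finsetSum _ fun i _ => integrable_finsetSum _ fun j _ => hEsq i j]
    simp only [integral_finsetSum _ fun j _ => hEsq _ j]
    calc ∑ i, ∑ j, ∫ ω, E ω i j * E ω i j ∂μ
        ≤ ∑ i : Fin m, ∑ j : Fin n, (v / N + δ ^ 2 * (G i j * G i j)) := by
          refine Finset.sum_le_sum fun i _ => Finset.sum_le_sum fun j _ => ?_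
          have hcomp := integral_sq_mean_smoothShrinkage_sub_le (μ := μ) (s := s) h0 h1 hg hc hN
            (x := fun l ω => ξ l ω i j) (fun l => (measurable_matrix_entry i j).comp (hξ l))
            (fun l l' hll => (hind hll).comp (measurable_matrix_entry i j)
              (measurable_matrix_entry i j)) (fun l => hlaw l i j) (G i j)
          have e : ∀ ω, E ω i j * E ω i j =
              ((N : ℝ)⁻¹ * ∑ l, smoothShrinkage c (G i j + ξ l ω i j) - G i j) ^ 2 := fun ω => by
            rw [← pow_two, ← clippedBatchMean_apply (smoothShrinkage c) G (fun l => ξ l ω) i j]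
            rfl
          rw [integral_congr_ae (ae_of_all _ e)]
          refine hcomp.trans (add_le_add (div_le_div_of_nonneg_right hv hNpos.le) ?_)
          have h3 := pow_le_pow_left₀ (abs_nonneg _) (hbias i j) 2
          rw [sq_abs, mul_pow, sq_abs] at h3
          linarith
      _ = _ := by
          simp only [Finset.sum_add_distrib, Finset.mul_sum, Finset.sum_const, Finset.card_univ,
            Fintype.card_fin, nsmul_eq_mul]
          ring
  have hv0 : 0 ≤ v := by
    refine le_trans ?_ hv
    have : 0 ≤ 1 - α := by linarith
    positivity
  have hGG := frobeniusInner_self_nonneg G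
  refine abs_le_of_sq_le_sq' ?_ (by positivity) |>.2
  have e1 := Real.sq_sqrt (show 0 ≤ (m : ℝ) * n * (v / N) by positivity)
  have e2 := Real.sq_sqrt hGG
  have e3 : 0 ≤ √((m : ℝ) * n * (v / N)) * (δ * √(frobeniusInner G G)) := by positivity
  nlinarith

end BatchMean

/-! ### Independence and descent along the iterates -/

/-- A bound that holds for almost every frozen value of `Y` integrates when `Y` and `Z` are
independent. -/
theorem integral_comp_le_of_indepFun {Ω β γ : Type*} [MeasurableSpace Ω] [MeasurableSpace β]
    [MeasurableSpace γ] {μ : Measure Ω} [IsProbabilityMeasure μ] {Y : Ω → β} {Z : Ω → γ}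
    (hY : Measurable Y) (hZ : Measurable Z) (hind : IndepFun Y Z μ) {H : β × γ → ℝ}
    (hH : Measurable H) (hint : Integrable (fun ω => H (Y ω, Z ω)) μ) {b : β → ℝ}
    (hb : Integrable (fun ω => b (Y ω)) μ)
    (hle : ∀ᵐ ω ∂μ, ∫ ω', H (Y ω, Z ω') ∂μ ≤ b (Y ω)) :
    ∫ ω, H (Y ω, Z ω) ∂μ ≤ ∫ ω, b (Y ω) ∂μ := by
  have hYZ : Measurable fun ω => (Y ω, Z ω) := hY.prodMk hZ
  have hprod := (indepFun_iff_map_prod_eq_prod_map_map hY.aemeasurable hZ.aemeasurable).1 hind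
  have := Measure.isProbabilityMeasure_map (μ := μ) hY.aemeasurable
  have := Measure.isProbabilityMeasure_map (μ := μ) hZ.aemeasurable
  have hintp : Integrable H ((μ.map Y).prod (μ.map Z)) := by
    rw [← hprod]
    exact (integrable_map_measure hH.aestronglyMeasurable hYZ.aemeasurable).2 hint
  have hinner : ∀ y, ∫ z, H (y, z) ∂μ.map Z = ∫ ω', H (y, Z ω') ∂μ := fun y =>
    integral_map hZ.aemeasurable (hH.comp measurable_prodMk_left).aestronglyMeasurable
  have e : ∫ ω, H (Y ω, Z ω) ∂μ = ∫ ω, ∫ z, H (Y ω, z) ∂μ.map Z ∂μ := by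
    calc ∫ ω, H (Y ω, Z ω) ∂μ = ∫ p, H p ∂μ.map fun ω => (Y ω, Z ω) :=
          (integral_map hYZ.aemeasurable hH.aestronglyMeasurable).symm
      _ = ∫ y, ∫ z, H (y, z) ∂μ.map Z ∂μ.map Y := by rw [hprod, integral_prod _ hintp]
      _ = _ := integral_map hY.aemeasurable hintp.integral_prod_left.aestronglyMeasurable
  rw [e]
  refine integral_mono_ae (hintp.integral_prod_left.comp_measurable hY) hb ?_
  filter_upwards [hle] with ω hω
  rwa [hinner]

section Iterates

variable {m n N : ℕ}

/-- Only the noise of the iterations before `k` has to be measurable, so the lemma also applies to the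
`σ`-algebra generated by that noise. -/
theorem measurable_preClippedMuon {Ω : Type*} [MeasurableSpace Ω]
    (f : Matrix (Fin m) (Fin n) ℝ → ℝ) {φ : ℝ → ℝ} (hφ : Measurable φ) (η : ℝ)
    (X₀ : Matrix (Fin m) (Fin n) ℝ) {Ξ : ℕ → Fin N → Ω → Matrix (Fin m) (Fin n) ℝ} :
    ∀ k, (∀ j < k, ∀ l, Measurable (Ξ j l)) → Measurable (preClippedMuon f φ η X₀ Ξ k)
  | 0, _ => measurable_const
  | k + 1, h => by
    have ih := measurable_preClippedMuon f hφ η X₀ k fun j hj => h j (Nat.lt_succ_of_lt hj)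
    have h1 : Measurable fun ω => (matrixGradient f (preClippedMuon f φ η X₀ Ξ k ω),
        fun l => Ξ k l ω) :=
      ((measurable_matrixGradient f).comp ih).prodMk
        (measurable_pi_lambda _ fun l => h k k.lt_succ_self l)
    have h2 := measurable_msign.comp ((measurable_clippedBatchMean hφ).comp h1)
    rw [measurable_matrix_iff] at ih h2 ⊢
    exact fun i j => (ih i j).sub ((h2 i j).const_mul η)

/-- The iterate `X k` is a function of the noise of the iterations before `k`, hence the gradient at
`X k` is independent of the noise of iteration `k`. -/
theorem indepFun_matrixGradient_preClippedMuon {Ω : Type*} [mΩ : MeasurableSpace Ω]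
    {μ : Measure Ω} (f : Matrix (Fin m) (Fin n) ℝ → ℝ) {φ : ℝ → ℝ} (hφ : Measurable φ) (η : ℝ)
    (X₀ : Matrix (Fin m) (Fin n) ℝ) {T : ℕ} {Ξ : ℕ → Fin N → Ω → Matrix (Fin m) (Fin n) ℝ}
    (hmeas : ∀ k < T, ∀ l, Measurable (Ξ k l))
    (hindep : iIndepFun (fun p : Fin T × Fin N => Ξ p.1 p.2) μ) {k : ℕ} (hk : k < T) :
    IndepFun (fun ω => matrixGradient f (preClippedMuon f φ η X₀ Ξ k ω)) (fun ω l => Ξ k l ω)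
      μ := by
  -- `σa p` is generated by the noise matrix with index `p = (iteration, sample)`
  let σa : Fin T × Fin N → MeasurableSpace Ω := fun p =>
    MeasurableSpace.comap (Ξ p.1 p.2) inferInstance
  have hle : ∀ p, σa p ≤ mΩ := fun p => (hmeas p.1 p.1.2 p.2).comap_le
  have hpast : Indep (⨆ p ∈ {p : Fin T × Fin N | (p.1 : ℕ) < k}, σa p)
      (⨆ p ∈ {p : Fin T × Fin N | (p.1 : ℕ) = k}, σa p) μ :=
    indep_iSup_of_disjoint hle hindep
      (Set.disjoint_left.2 fun p (hp : (p.1 : ℕ) < k) (hp' : (p.1 : ℕ) = k) => hp.ne hp')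
  have hmem : ∀ (S : Set (Fin T × Fin N)) (p : Fin T × Fin N), p ∈ S →
      Measurable[⨆ p ∈ S, σa p] (Ξ p.1 p.2) := fun S p hp =>
    (comap_measurable (Ξ p.1 p.2)).mono (le_iSup₂ (f := fun p (_ : p ∈ S) => σa p) p hp) le_rfl
  have hX : Measurable[⨆ p ∈ {p : Fin T × Fin N | (p.1 : ℕ) < k}, σa p]
      (fun ω => matrixGradient f (preClippedMuon f φ η X₀ Ξ k ω)) :=
    (measurable_matrixGradient f).comp
      (@measurable_preClippedMuon m n N Ω (⨆ p ∈ {p : Fin T × Fin N | (p.1 : ℕ) < k}, σa p)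
        f φ hφ η X₀ Ξ k fun j hj l => hmem _ (⟨j, hj.trans hk⟩, l) hj)
  have hZ : Measurable[⨆ p ∈ {p : Fin T × Fin N | (p.1 : ℕ) = k}, σa p]
      (fun ω l => Ξ k l ω) :=
    @measurable_pi_lambda _ _ _ (⨆ p ∈ {p : Fin T × Fin N | (p.1 : ℕ) = k}, σa p) _ _
      fun l => hmem _ (⟨k, hk⟩, l) rfl
  exact indep_of_indep_of_le_left (indep_of_indep_of_le_right hpast hZ.comap_le) hX.comap_le

end Iterates

section Descent

variable {m n : ℕ}

/-- The matrix sign of an estimate `b` of `G` is a good direction for `G`, up to the estimation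
error: `‖G‖_* = ⟨b, msign G⟩ - ⟨b - G, msign G⟩`, and `⟨b, msign G⟩ ≤ ⟨b, msign b⟩`. -/
theorem nuclearNorm_le_frobeniusInner_msign_add (G b : Matrix (Fin m) (Fin n) ℝ) :
    nuclearNorm G ≤ frobeniusInner G (msign b) +
      2 * √(min m n : ℕ) * √(frobeniusInner (b - G) (b - G)) := by
  have hO : ∀ A : Matrix (Fin m) (Fin n) ℝ, |frobeniusInner (b - G) (msign A)| ≤
      √(min m n : ℕ) * √(frobeniusInner (b - G) (b - G)) := fun A => by
    rw [mul_comm]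
    exact (abs_frobeniusInner_le _ _).trans (mul_le_mul_of_nonneg_left
      (Real.sqrt_le_sqrt (frobeniusInner_msign_self_le A)) (Real.sqrt_nonneg _))
  have h1 := abs_le.1 (hO b)
  have h2 := abs_le.1 (hO G)
  have h3 := frobeniusInner_msign_le b G
  rw [frobeniusInner_sub_left b G (msign _)] at h1 h2
  rw [nuclearNorm_eq_frobeniusInner_msign]
  linarith [h1.2, h2.1]

/-- Summing the smoothness inequality along steps `x (k + 1) = x k - η * msign (b k)`. -/
theorem sum_nuclearNorm_le {f : Matrix (Fin m) (Fin n) ℝ → ℝ} {L : ℝ} (hL : 0 ≤ L)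
    (hf : IsSmoothObjective f L) {η : ℝ} (hη : 0 ≤ η) {x b : ℕ → Matrix (Fin m) (Fin n) ℝ}
    (hx : ∀ k, x (k + 1) = x k - η • msign (b k)) (T : ℕ) :
    η * ∑ k ∈ Finset.range T, nuclearNorm (matrixGradient f (x k)) ≤
      f (x 0) - f (x T) + T * (L / 2 * η ^ 2 * (min m n : ℕ)) +
        η * ∑ k ∈ Finset.range T, 2 * √(min m n : ℕ) *
          √(frobeniusInner (b k - matrixGradient f (x k)) (b k - matrixGradient f (x k))) := by
  induction T with
  | zero => simp
  | succ T ih =>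
    rw [Finset.sum_range_succ, Finset.sum_range_succ]
    have h1 := hf.2 (x T) (x (T + 1))
    have e : x (T + 1) - x T = (-η) • msign (b T) := by
      rw [hx, neg_smul]
      abel
    rw [e, frobeniusInner_smul_right, frobeniusInner_smul_right,
      frobeniusInner_comm ((-η) • msign (b T)) (msign (b T)), frobeniusInner_smul_right] at h1
    have h2 := mul_le_mul_of_nonneg_left
      (nuclearNorm_le_frobeniusInner_msign_add (matrixGradient f (x T)) (b T)) hη
    have h3 := mul_le_mul_of_nonneg_left (frobeniusInner_msign_self_le (b T))
      (by positivity : 0 ≤ L / 2 * η ^ 2)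
    push_cast at h2 h3 ih ⊢
    linarith

theorem matrixGradient_eq_zero_of_isMin {f : Matrix (Fin m) (Fin n) ℝ → ℝ}
    {X : Matrix (Fin m) (Fin n) ℝ} (h : ∀ Y, f X ≤ f Y) : matrixGradient f X = 0 := by
  have h1 : fderiv ℝ (E := Fin m → Fin n → ℝ) f X = 0 :=
    IsLocalMin.fderiv_eq_zero (E := Fin m → Fin n → ℝ) (Filter.Eventually.of_forall h)
  ext i j
  exact congrArg (fun D => D (Matrix.single i j 1)) h1

end Descent

/-! ### The convergence rate -/

/-- The lower bounds on `c` force `c > 0`: the first one if `α < 1`, the second one if `α = 1`. -/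
theorem threshold_pos {r α σ γ B c : ℝ} (hr : 0 < r) (hα₀ : 0 ≤ α) (hα₁ : α ≤ 1) (hσ : 0 < σ)
    (hγ : 0 < γ) (hB : 0 ≤ B) (hc1 : 8 * √r * (B + √(8 / Real.pi) * (1 - α) * σ) ≤ c)
    (hc2 : 128 * α * γ * √r / Real.pi *
      Real.log (Real.exp 1 + 128 * α * √r / Real.pi) ≤ c) : 0 < c := by
  have hR : 0 < √r := Real.sqrt_pos.2 hr
  rcases hα₁.lt_or_eq with h | rfl
  · have : 0 < 1 - α := by linarith
    exact lt_of_lt_of_le (by positivity) hc1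
  · have : 0 < Real.log (Real.exp 1 + 128 * 1 * √r / Real.pi) := by
      refine Real.log_pos ?_
      have : 0 < 128 * 1 * √r / Real.pi := by positivity
      linarith [Real.add_one_le_exp 1]
    exact lt_of_lt_of_le (by positivity) hc2

theorem theorem4p4 {Ω : Type*} [MeasurableSpace Ω] (μ : Measure Ω) [IsProbabilityMeasure μ]
    {m n : ℕ} (hm : 0 < m) (hn : 0 < n)
    -- the smooth objective, bounded below, and the starting point
    (f : Matrix (Fin m) (Fin n) ℝ → ℝ) (L : ℝ) (hL : 0 < L) (hf : IsSmoothObjective f L)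
    (hbelow : BddBelow (Set.range f)) (X₀ : Matrix (Fin m) (Fin n) ℝ)
    (Δ : ℝ) (hΔ : Δ = f X₀ - ⨅ X, f X)
    -- the number of iterations, the batch size and the dimensional constants
    (T N : ℕ) (hT : 0 < T) (hN : 0 < N)
    (r q : ℕ) (hr : r = min m n) (hq : q = max m n) (D : ℝ) (hD : D = √((q : ℝ) / r))
    -- the noise: independent over iterations and samples, identically distributed over samples,
    -- each entry following the Gaussian-Cauchy mixture law
    (Ξ : ℕ → Fin N → Ω → Matrix (Fin m) (Fin n) ℝ)
    (hmeas : ∀ k < T, ∀ l, Measurable (Ξ k l))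
    (hindep : iIndepFun (fun p : Fin T × Fin N => Ξ p.1 p.2) μ)
    (hident : ∀ k < T, ∀ l l', IdentDistrib (Ξ k l) (Ξ k l') μ μ)
    (α : ℝ) (hα₀ : 0 ≤ α) (hα₁ : α ≤ 1) (σ γ : ℝ) (hσ : 0 < σ) (hγ : 0 < γ)
    (σs γs : ℕ → ℝ≥0) (hσs : ∀ k < T, (σs k : ℝ) ≤ σ)
    (hγs₀ : ∀ k < T, 0 < γs k) (hγs : ∀ k < T, (γs k : ℝ) ≤ γ)
    (hlaw : ∀ k < T, ∀ l i j,
      μ.map (fun ω => Ξ k l ω i j) = gaussianCauchyMixture α (σs k) (γs k))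
    -- the threshold, the variance proxy and the step size
    (B c : ℝ)
    (hc : max
        (8 * √(r : ℝ) * (B + √(8 / Real.pi) * (1 - α) * σ))
        (128 * α * γ * √(r : ℝ) / Real.pi *
          Real.log (Real.exp 1 + 128 * α * √(r : ℝ) / Real.pi)) ≤ c)
    (v : ℝ) (hv : v = (1 - α) * σ ^ 2 + 8 * α * γ * c / (Real.pi * Real.exp 1))
    (η : ℝ) (hη : η = √(2 * Δ / (L * r * T)))
    -- the iterates and their gradients, which are bounded by `B` entry by entry
    (X : ℕ → Ω → Matrix (Fin m) (Fin n) ℝ)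
    (hX : X = preClippedMuon f (smoothShrinkage c) η X₀ Ξ)
    (G : ℕ → Ω → Matrix (Fin m) (Fin n) ℝ) (hG : ∀ k ω, G k ω = matrixGradient f (X k ω))
    (hB : ∀ k < T, ∀ᵐ ω ∂μ, ∀ i j, |G k ω i j| ≤ B) :
    (∀ k < T, Integrable (fun ω => nuclearNorm (G k ω)) μ) ∧
    (1 / (T : ℝ)) * ∑ k ∈ Finset.range T, ∫ ω, nuclearNorm (G k ω) ∂μ ≤
      2 * √(2 * L * r * Δ / T) + 4 * D * (r : ℝ) ^ (3 / 2 : ℝ) * √(v / N) ∧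
    ∀ ε : ℝ, 0 < ε → 32 * L * r * Δ / ε ^ 2 ≤ T → 64 * D ^ 2 * (r : ℝ) ^ 3 * v / ε ^ 2 ≤ N →
      (1 / (T : ℝ)) * ∑ k ∈ Finset.range T, ∫ ω, nuclearNorm (G k ω) ∂μ ≤ ε := by
  have hr0 : 0 < r := by rw [hr]; exact lt_min hm hn
  have hrpos : (0 : ℝ) < r := by exact_mod_cast hr0
  have hTpos : (0 : ℝ) < T := by exact_mod_cast hT
  have hNpos : (0 : ℝ) < N := by exact_mod_cast hN
  have hR : 0 < √(r : ℝ) := Real.sqrt_pos.2 hrpos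
  have hB0 : 0 ≤ B := by
    obtain ⟨ω, hω⟩ := (hB 0 hT).exists
    exact (abs_nonneg _).trans (hω ⟨0, hm⟩ ⟨0, hn⟩)
  have hc1 := (le_max_left _ _).trans hc
  have hc2 := (le_max_right _ _).trans hc
  have hc0 : 0 < c := threshold_pos hrpos hα₀ hα₁ hσ hγ hB0 hc1 hc2
  have hv0 : 0 ≤ v := by
    have : 0 ≤ 1 - α := by linarith
    rw [hv]; positivity
  have hDr : 0 ≤ D := by rw [hD]; exact Real.sqrt_nonneg _
  have hmn : (m : ℝ) * n = r * q := by
    rw [hr, hq]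
    exact_mod_cast (min_mul_max m n).symm
  -- the dimensional constant: `√(m n) = r D`
  have hstd : √((m : ℝ) * n * (v / N)) = r * D * √(v / N) := by
    have e : (m : ℝ) * n * (v / N) = (r : ℝ) ^ 2 * ((q : ℝ) / r) * (v / N) := by
      rw [hmn]; field_simp
    rw [e, Real.sqrt_mul (by positivity), Real.sqrt_mul (by positivity), Real.sqrt_sq hrpos.le,
      hD]
  have hSm : Measurable (smoothShrinkage c) := (continuous_smoothShrinkage c).measurable
  have hXm : ∀ k < T, Measurable (X k) := fun k hk => by
    rw [hX]
    exact measurable_preClippedMuon f hSm η X₀ k fun j hj => hmeas j (hj.trans hk)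
  have hGfun : ∀ k, G k = fun ω => matrixGradient f (X k ω) := fun k => funext (hG k)
  have hGm : ∀ k < T, Measurable (G k) := fun k hk => by
    rw [hGfun]
    exact (measurable_matrixGradient f).comp (hXm k hk)
  set b : ℕ → Ω → Matrix (Fin m) (Fin n) ℝ := fun k ω =>
    clippedBatchMean (smoothShrinkage c) (G k ω) fun l => Ξ k l ω with hb
  have hstep : ∀ k ω, X (k + 1) ω = X k ω - η • msign (b k ω) := fun k ω => by
    simp only [hb, hG, hX]
    rfl
  -- the Frobenius norm of the estimation error
  let H : Matrix (Fin m) (Fin n) ℝ × (Fin N → Matrix (Fin m) (Fin n) ℝ) → ℝ := fun p =>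
    √(frobeniusInner (clippedBatchMean (smoothShrinkage c) p.1 p.2 - p.1)
      (clippedBatchMean (smoothShrinkage c) p.1 p.2 - p.1))
  have hHm : Measurable H := by
    have h1 : ∀ i j, Measurable fun p : Matrix (Fin m) (Fin n) ℝ ×
        (Fin N → Matrix (Fin m) (Fin n) ℝ) =>
        (clippedBatchMean (smoothShrinkage c) p.1 p.2 - p.1) i j := fun i j =>
      (measurable_matrix_iff.1 (measurable_clippedBatchMean hSm) i j).sub
        ((measurable_matrix_entry i j).comp measurable_fst)
    exact (measurable_frobeniusInner h1 h1).sqrt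
  have hZm : ∀ k < T, Measurable fun ω l => Ξ k l ω := fun k hk =>
    measurable_pi_lambda _ (hmeas k hk)
  have hHint : ∀ k < T, Integrable (fun ω => H (G k ω, fun l => Ξ k l ω)) μ := fun k hk => by
    refine Integrable.of_bound (hHm.comp ((hGm k hk).prodMk (hZm k hk))).aestronglyMeasurable
      (√(m * n * (c / Real.exp 1 + B) ^ 2)) ?_
    filter_upwards [hB k hk] with ω hω
    rw [Real.norm_eq_abs, abs_of_nonneg (Real.sqrt_nonneg _)]
    exact sqrt_frobeniusInner_self_le_of_abs_le fun i j => (abs_sub _ _).trans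
      (add_le_add (abs_clippedBatchMean_le hc0 hN _ _ i j) (hω i j))
  have hFm : ∀ k < T, Measurable fun ω => √(frobeniusInner (G k ω) (G k ω)) := fun k hk =>
    (measurable_frobeniusInner (measurable_matrix_iff.1 (hGm k hk))
      (measurable_matrix_iff.1 (hGm k hk))).sqrt
  have hFint : ∀ k < T, Integrable (fun ω => √(frobeniusInner (G k ω) (G k ω))) μ :=
    fun k hk => by
    refine Integrable.of_bound (hFm k hk).aestronglyMeasurable (√(m * n * B ^ 2)) ?_
    filter_upwards [hB k hk] with ω hω
    rw [Real.norm_eq_abs, abs_of_nonneg (Real.sqrt_nonneg _)]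
    exact sqrt_frobeniusInner_self_le_of_abs_le hω
  have hnuc0 : ∀ A : Matrix (Fin m) (Fin n) ℝ, √(frobeniusInner A A) ≤ nuclearNorm A :=
    fun A => by
    rw [nuclearNorm_eq_frobeniusInner_msign]
    exact sqrt_frobeniusInner_self_le A
  have hIint : ∀ k < T, Integrable (fun ω => nuclearNorm (G k ω)) μ := fun k hk => by
    refine ((hFint k hk).mul_const √((min m n : ℕ) : ℝ)).mono'
      (measurable_nuclearNorm.comp (hGm k hk)).aestronglyMeasurable (ae_of_all _ fun ω => ?_)
    rw [Real.norm_eq_abs, abs_of_nonneg ((Real.sqrt_nonneg _).trans (hnuc0 _)),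
      nuclearNorm_eq_frobeniusInner_msign]
    exact (le_abs_self _).trans ((abs_frobeniusInner_le _ _).trans (mul_le_mul_of_nonneg_left
      (Real.sqrt_le_sqrt (frobeniusInner_msign_self_le _)) (Real.sqrt_nonneg _)))
  -- the bias is absorbed as a fraction of the nuclear norm of the gradient
  have herr : ∀ k < T, ∫ ω, H (G k ω, fun l => Ξ k l ω) ∂μ ≤
      r * D * √(v / N) + 1 / (4 * √(r : ℝ)) * ∫ ω, nuclearNorm (G k ω) ∂μ := fun k hk => by
    have hg0 : γs k ≠ 0 := (hγs₀ k hk).ne'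
    have hind : IndepFun (G k) (fun ω l => Ξ k l ω) μ := by
      rw [hGfun, hX]
      exact indepFun_matrixGradient_preClippedMuon f hSm η X₀ hmeas hindep hk
    have hbudget := relative_bias_le hrpos hα₀ hα₁ hB0 (σs k).2 (hσs k hk)
      (NNReal.coe_pos.2 (hγs₀ k hk)) (hγs k hk) hc0 hc1 hc2
    have hvk : (1 - α) * (σs k : ℝ) ^ 2 + 8 * α * (γs k : ℝ) * c / (Real.pi * Real.exp 1) ≤ v := by
      rw [hv]
      refine add_le_add (mul_le_mul_of_nonneg_left
        (pow_le_pow_left₀ (σs k).2 (hσs k hk) 2) (by linarith))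
        (div_le_div_of_nonneg_right (mul_le_mul_of_nonneg_right
          (mul_le_mul_of_nonneg_left (hγs k hk) (by positivity)) hc0.le) (by positivity))
    have key := integral_comp_le_of_indepFun (hGm k hk) (hZm k hk) hind hHm (hHint k hk)
      (b := fun A => √(m * n * (v / N)) + 1 / (4 * √(r : ℝ)) * √(frobeniusInner A A))
      ((integrable_const _).add ((hFint k hk).const_mul _)) (by
        filter_upwards [hB k hk] with ω hω
        refine integral_sqrt_frobeniusInner_batchMean_sub_le hα₀ hα₁ hg0 hc0 hN (hmeas k hk)
          (fun l l' hll => ?_) (hlaw k hk) hvk (by positivity) (G k ω) fun i j => ?_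
        · exact hindep.indepFun (i := ((⟨k, hk⟩ : Fin T), l)) (j := ((⟨k, hk⟩ : Fin T), l'))
            fun h => hll (Prod.ext_iff.1 h).2
        · refine (abs_integral_smoothShrinkage_sub_le hα₀ hα₁ hg0 hc0 _).trans
            (mul_le_mul_of_nonneg_left (le_trans ?_ hbudget) (abs_nonneg _))
          exact add_le_add_left (div_le_div_of_nonneg_right (hω i j) hc0.le) _)
    refine key.trans ?_
    rw [integral_add (integrable_const _) ((hFint k hk).const_mul _), integral_const_mul,
      integral_const, probReal_univ, one_smul, hstd]
    gcongr
    · exact hFint k hk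
    · exact hIint k hk
    · exact fun ω => hnuc0 _
  have hΔ0 : 0 ≤ Δ := by
    rw [hΔ]
    exact sub_nonneg.2 (ciInf_le hbelow X₀)
  have hη0 : 0 ≤ η := by rw [hη]; exact Real.sqrt_nonneg _
  have hmain : (1 / (T : ℝ)) * ∑ k ∈ Finset.range T, ∫ ω, nuclearNorm (G k ω) ∂μ ≤
      2 * √(2 * L * r * Δ / T) + 4 * D * (r : ℝ) ^ (3 / 2 : ℝ) * √(v / N) := by
    rcases hΔ0.eq_or_lt with hΔz | hΔp
    · -- `X₀` is a minimizer and the step size is zero, so every gradient vanishes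
      have hηz : η = 0 := by rw [hη, ← hΔz]; simp
      have hXc : ∀ k ω, X k ω = X₀ := fun k ω => by
        induction k with
        | zero => rw [hX]; rfl
        | succ k ih => rw [hstep, hηz, zero_smul, sub_zero, ih]
      have hgrad : matrixGradient f X₀ = 0 := matrixGradient_eq_zero_of_isMin fun Y => by
        have := ciInf_le hbelow Y
        linarith
      have hz : ∀ k, ∫ ω, nuclearNorm (G k ω) ∂μ = 0 := fun k => by
        simp [hG, hXc, hgrad, nuclearNorm]
      simp only [hz, Finset.sum_const_zero, mul_zero]
      positivity
    · have hηp : 0 < η := by rw [hη]; exact Real.sqrt_pos.2 (by positivity)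
      -- with this step size `2 Δ / (η T) = L r η`
      have hηsq : η ^ 2 * (L * r * T) = 2 * Δ := by
        rw [hη, Real.sq_sqrt (by positivity)]
        field_simp
      have hpt : ∀ ω, η * ∑ k ∈ Finset.range T, nuclearNorm (G k ω) ≤
          Δ + T * (L / 2 * η ^ 2 * r) + η * ∑ k ∈ Finset.range T, 2 * √(r : ℝ) *
            H (G k ω, fun l => Ξ k l ω) := fun ω => by
        have h1 := sum_nuclearNorm_le hL.le hf hη0 (x := fun k => X k ω) (b := fun k => b k ω)
          (fun k => hstep k ω) T
        have h2 : f (X 0 ω) = f X₀ := by rw [hX]; rfl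
        have h3 := ciInf_le hbelow (X T ω)
        simp only [← hG, ← hr, h2] at h1
        refine h1.trans ?_
        gcongr
        rw [hΔ]
        linarith
      have hRHSint : ∀ k ∈ Finset.range T,
          Integrable (fun ω => 2 * √(r : ℝ) * H (G k ω, fun l => Ξ k l ω)) μ := fun k hk =>
        (hHint k (Finset.mem_range.1 hk)).const_mul _
      have hLHSint : ∀ k ∈ Finset.range T, Integrable (fun ω => nuclearNorm (G k ω)) μ :=
        fun k hk => hIint k (Finset.mem_range.1 hk)
      have hexp := integral_mono ((integrable_finsetSum _ hLHSint).const_mul η)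
        ((integrable_const (μ := μ) (Δ + T * (L / 2 * η ^ 2 * r))).add
          ((integrable_finsetSum _ hRHSint).const_mul η)) hpt
      rw [integral_const_mul, integral_finsetSum _ hLHSint] at hexp
      have e1 := integral_add (integrable_const (μ := μ) (Δ + T * (L / 2 * η ^ 2 * r)))
        ((integrable_finsetSum _ hRHSint).const_mul η)
      rw [integral_const_mul, integral_finsetSum _ hRHSint] at e1
      simp only [integral_const, probReal_univ, one_smul, integral_const_mul] at e1
      have hsum : ∑ k ∈ Finset.range T, 2 * √(r : ℝ) * ∫ ω, H (G k ω, fun l => Ξ k l ω) ∂μ ≤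
          ∑ k ∈ Finset.range T, (2 * √(r : ℝ) * (r * D * √(v / N)) +
            1 / 2 * ∫ ω, nuclearNorm (G k ω) ∂μ) := by
        refine Finset.sum_le_sum fun k hk => ?_
        refine (mul_le_mul_of_nonneg_left (herr k (Finset.mem_range.1 hk))
          (by positivity)).trans_eq ?_
        field_simp
        ring
      rw [Finset.sum_add_distrib, ← Finset.mul_sum _ _ (1 / 2 : ℝ), Finset.sum_const, Finset.card_range,
        nsmul_eq_mul] at hsum
      set S := ∑ k ∈ Finset.range T, ∫ ω, nuclearNorm (G k ω) ∂μ
      have hfin : η * S ≤ Δ + T * (L / 2 * η ^ 2 * r) +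
          η * (T * (2 * √(r : ℝ) * (r * D * √(v / N))) + 1 / 2 * S) :=
        (hexp.trans_eq e1).trans (add_le_add_right (mul_le_mul_of_nonneg_left hsum hη0) _)
      have hS : S ≤ T * (2 * (L * r * η) + 4 * √(r : ℝ) * (r * D * √(v / N))) := by
        refine le_of_mul_le_mul_left ?_ hηp
        linarith
      have hroot : L * r * η = √(2 * L * r * Δ / T) := by
        rw [hη]
        nth_rewrite 1 [← Real.sqrt_sq (show 0 ≤ L * r by positivity)]
        rw [← Real.sqrt_mul (sq_nonneg _)]
        congr 1
        field_simp
      have hpow : (r : ℝ) ^ (3 / 2 : ℝ) = √(r : ℝ) * r := by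
        rw [show (3 / 2 : ℝ) = 1 / 2 + 1 by norm_num, Real.rpow_add hrpos, Real.rpow_one,
          Real.sqrt_eq_rpow]
      rw [one_div, inv_mul_le_iff₀ hTpos, hpow, ← hroot]
      refine hS.trans_eq ?_
      ring
  refine ⟨hIint, hmain, fun ε hε h1 h2 => hmain.trans ?_⟩
  have hε2 : 0 < ε ^ 2 := by positivity
  have b1 : √(2 * L * r * Δ / T) ≤ ε / 4 := by
    refine Real.sqrt_le_iff.2 ⟨by positivity, ?_⟩
    rw [div_le_iff₀ hε2] at h1
    rw [div_le_iff₀ hTpos]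
    linarith
  have b2 : D * (r : ℝ) ^ (3 / 2 : ℝ) * √(v / N) ≤ ε / 8 := by
    refine abs_le_of_sq_le_sq' ?_ (by positivity) |>.2
    have hp : ((r : ℝ) ^ (3 / 2 : ℝ)) ^ 2 = (r : ℝ) ^ 3 := by
      rw [← Real.rpow_mul_natCast hrpos.le, ← Real.rpow_natCast]
      norm_num
    rw [mul_pow, mul_pow, Real.sq_sqrt (by positivity), hp]
    rw [div_le_iff₀ hε2] at h2
    rw [← mul_div_assoc, div_le_iff₀ hNpos]
    linarith
  linarith
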